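/- **Conventions.** For a smooth immersed oriented surface patch $X$ in $\mathbb{R}^3$ with unit normal $\nu$, let $g_{ij}=\langle X_{,i},X_{,j}\rangle$, $h_{ij}=-\langle X_{,ij},\nu\rangle$, let $\lambda_1,\lambda_2$ be the principal curvatures (the eigenvalues of $h$ with respect to $g$), $K=\lambda_1\lambda_2=\det h/\det g$ the Gauss curvature, and let semicolons denote covariant derivatives. The patch is strictly convex if $(h_{ij})$ is positive definite; $\nu$ is then the outer normal. For a normal velocity $F=F(h_{ij},g_{ij})$, put $F^{ij}=\partial F/\partial h_{ij}$. For a smooth family $X(\cdot,t)$ of strictly convex patches moving at the instant considered by $\frac{d}{dt}X=-F\nu$, and a function $w$ of the principal curvatures, put at that instant $$L(w)=\tfrac{d}{dt}w-F^{ij}w_{;ij}.$$ **Definition.** Let $w=p(\lambda_1,\lambda_2)/q(\lambda_1,\lambda_2)$ be a symmetric rational function, where $p,q\not\equiv0$ are homogeneous real polynomials. It is a *maximum-principle function* for $F$ if * (I) $p(\lambda_1,\lambda_2)\ge 0$ and $q(\lambda_1,\lambda_2)>0$ for all $\lambda_1,\lambda_2>0$, and $p(\lambda,\lambda)=0$ for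 all $\lambda>0$; * (II) $\deg p>\deg q$; * (III) $\frac{\partial}{\partial\rho}w(\rho,1)<0$ for $0<\rho<1$ and $\frac{\partial}{\partial\rho}w(\rho,1)>0$ for $\rho>1$; * (IV) for all $\lambda_1,\lambda_2>0$: (a) the terms of $L(w)$ without derivatives of $(h_{ij})$ are nonpositive, i.e. $L(w)\le0$ at every point of such a family, at such an instant, where all $h_{ij;k}$ vanish; (b) the terms of $L(w)$ involving derivatives of $(h_{ij})$ are nonpositive at critical points of $w$, i.e. at every point where $w_{;1}=w_{;2}=0$, the value of $L(w)$ is at most its value at any point (of any such family) with the same principal curvatures where all $h_{ij;k}$ vanish. **Theorem.** Let $\sigma>1$. There is no maximum-principle function for the normal velocity $F=K^\sigma$, i.e. for smooth strictly convex surfaces in $\mathbb{R}^3$ moving by $\frac{d}{dt}X=-K^\sigma\nu$. -/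

import Mathlib

open scoped ContDiff Matrix

namespace MPF

/-! ### Local differential geometry of parametrized surfaces in Euclidean space -/

/-- Coordinates on a surface patch. -/
abbrev Param := Fin 2 → ℝ

/-- Ambient Euclidean 3-space; the inner product is `⬝ᵥ`, the vector product is `⨯₃`. -/
abbrev Space := Fin 3 → ℝ

abbrev Mat2 := Matrix (Fin 2) (Fin 2) ℝ

/-- The partial derivative `f_{,i}`. -/
noncomputable def pd {E : Type*} [NormedAddCommGroup E] [NormedSpace ℝ E]
    (i : Fin 2) (f : Param → E) (x : Param) : E :=
  fderiv ℝ f x (Pi.single i 1)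

/-- The induced metric `g_{ij} = ⟨X_{,i}, X_{,j}⟩`. -/
noncomputable def metric (X : Param → Space) (x : Param) : Mat2 :=
  Matrix.of fun i j => pd i X x ⬝ᵥ pd j X x

/-- `X_{,1} × X_{,2}`. -/
noncomputable def crossNormal (X : Param → Space) (x : Param) : Space :=
  crossProduct (pd 0 X x) (pd 1 X x)

/-- The unit normal `ν = X_{,1} × X_{,2} / |X_{,1} × X_{,2}|`. On a strictly convex patch (see
`IsFlowAt`) the parametrization is oriented so that this is the outer one. -/
noncomputable def normal (X : Param → Space) (x : Param) : Space :=
  (Real.sqrt (crossNormal X x ⬝ᵥ crossNormal X x))⁻¹ • crossNormal X x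

/-- The second fundamental form `h_{ij} = -⟨X_{,ij}, ν⟩`. -/
noncomputable def secondForm (X : Param → Space) (x : Param) : Mat2 :=
  Matrix.of fun i j => -(pd j (pd i X) x ⬝ᵥ normal X x)

/-- Christoffel symbols
`Γ^k_{ij} = ½ g^{kl} (g_{il,j} + g_{jl,i} - g_{ij,l})`. -/
noncomputable def christoffel (X : Param → Space) (k i j : Fin 2) (x : Param) : ℝ :=
  (1 / 2) * ∑ l, (metric X x)⁻¹ k l *
    (pd j (fun y => metric X y i l) x + pd i (fun y => metric X y j l) x
      - pd l (fun y => metric X y i j) x)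

/-- The covariant derivative `h_{ij;k}` of the second fundamental form. -/
noncomputable def covSecondForm (X : Param → Space) (i j k : Fin 2) (x : Param) : ℝ :=
  pd k (fun y => secondForm X y i j) x
    - ∑ l, christoffel X l i k x * secondForm X x l j
    - ∑ l, christoffel X l j k x * secondForm X x i l

/-- The second covariant derivative `f_{;ij}` of a function on the surface. -/
noncomputable def covHess (X : Param → Space) (f : Param → ℝ) (i j : Fin 2) (x : Param) : ℝ :=
  pd j (pd i f) x - ∑ k, christoffel X k i j x * pd k f x

/-- The trace `g^{ij} h_{ij}` of a symmetric form `h` with respect to the metric `g`. -/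
noncomputable def meanCurv (h g : Mat2) : ℝ := (g⁻¹ * h).trace

/-- `det h / det g`. -/
noncomputable def gaussCurv (h g : Mat2) : ℝ := h.det / g.det

/-- The larger eigenvalue of `h` with respect to `g`; see `charpoly_weingarten`. -/
noncomputable def kappaMax (h g : Mat2) : ℝ :=
  (meanCurv h g + Real.sqrt (meanCurv h g ^ 2 - 4 * gaussCurv h g)) / 2

/-- The smaller eigenvalue of `h` with respect to `g`; see `charpoly_weingarten`. -/
noncomputable def kappaMin (h g : Mat2) : ℝ :=
  (meanCurv h g - Real.sqrt (meanCurv h g ^ 2 - 4 * gaussCurv h g)) / 2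

theorem discrim_nonneg {h g : Mat2} (hg : g.PosDef) (hh : h.IsSymm) :
    0 ≤ meanCurv h g ^ 2 - 4 * gaussCurv h g := by
  have hdet : 0 < g.det := hg.det_pos
  have ha : 0 < g 0 0 := hg.diag_pos
  have hgs : g 1 0 = g 0 1 := by simpa using hg.isHermitian.apply 0 1
  have hhs : h 1 0 = h 0 1 := hh.apply 0 1
  have hd : g.det = g 0 0 * g 1 1 - g 0 1 * g 0 1 := by rw [Matrix.det_fin_two, hgs]
  have hH : meanCurv h g * g.det =
      g 1 1 * h 0 0 - 2 * g 0 1 * h 0 1 + g 0 0 * h 1 1 := by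
    simp only [meanCurv, Matrix.inv_def, Matrix.adjugate_fin_two, Ring.inverse_eq_inv',
      Matrix.trace_fin_two, Matrix.smul_mul, Matrix.smul_apply, Matrix.mul_apply,
      Fin.sum_univ_two, Matrix.of_apply, Matrix.cons_val', Matrix.cons_val_zero,
      Matrix.cons_val_one, smul_eq_mul, hgs, hhs]
    field_simp
    ring
  have hK : gaussCurv h g * g.det = h 0 0 * h 1 1 - h 0 1 * h 0 1 := by
    rw [gaussCurv, div_mul_cancel₀ _ hdet.ne', Matrix.det_fin_two, hhs]
  have key : (g 0 0 * g.det) ^ 2 * (meanCurv h g ^ 2 - 4 * gaussCurv h g) =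
      (g 0 0 * (g 0 0 * h 1 1 - g 1 1 * h 0 0)
        - 2 * g 0 1 * (g 0 0 * h 0 1 - g 0 1 * h 0 0)) ^ 2
      + 4 * g.det * (g 0 0 * h 0 1 - g 0 1 * h 0 0) ^ 2 := by
    have e : (g 0 0 * g.det) ^ 2 * (meanCurv h g ^ 2 - 4 * gaussCurv h g) =
        g 0 0 ^ 2 * ((meanCurv h g * g.det) ^ 2 - 4 * g.det * (gaussCurv h g * g.det)) := by
      ring
    rw [e, hH, hK, hd]
    ring
  have hpos : 0 < (g 0 0 * g.det) ^ 2 := by positivity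
  have hnn : 0 ≤ (g 0 0 * g.det) ^ 2 * (meanCurv h g ^ 2 - 4 * gaussCurv h g) := by
    rw [key]; positivity
  exact nonneg_of_mul_nonneg_right hnn hpos

/-- `kappaMax` and `kappaMin` are the principal curvatures: the eigenvalues, with multiplicity,
of `h` with respect to `g`. -/
theorem charpoly_weingarten {h g : Mat2} (hg : g.PosDef) (hh : h.IsSymm) :
    (g⁻¹ * h).charpoly =
      (Polynomial.X - Polynomial.C (kappaMax h g)) *
        (Polynomial.X - Polynomial.C (kappaMin h g)) := by
  have hD := discrim_nonneg hg hh
  have hs : kappaMax h g + kappaMin h g = (g⁻¹ * h).trace := by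
    simp only [kappaMax, kappaMin, meanCurv]; ring
  have hp : kappaMax h g * kappaMin h g = (g⁻¹ * h).det := by
    have h1 : kappaMax h g * kappaMin h g = gaussCurv h g := by
      have := Real.sq_sqrt hD
      simp only [kappaMax, kappaMin]
      nlinarith
    rw [h1, gaussCurv, Matrix.det_mul, Matrix.det_nonsing_inv, Ring.inverse_eq_inv']
    ring
  rw [Matrix.charpoly_fin_two, ← hs, ← hp, Polynomial.C_add, Polynomial.C_mul]
  ring

/-! ### Normal velocities and instantaneous flows -/

/-- The normal velocity `K^σ`. A normal velocity is regarded as a function of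
`(h_{ij}, g_{ij})`. -/
noncomputable def gaussPower (σ : ℝ) (h g : Mat2) : ℝ := gaussCurv h g ^ σ

/-- `F^{ij} = ∂F / ∂h_{ij}`. -/
noncomputable def velocityDeriv (F : Mat2 → Mat2 → ℝ) (h g : Mat2) (i j : Fin 2) : ℝ :=
  deriv (fun s : ℝ => F (h + s • Matrix.single i j 1) g) 0

/-- `X` is, on the open space-time set `W`, a smooth family of strictly convex surface patches
whose motion at the instant `t₀` is the flow `dX/dt = -F ν`.

Strict convexity is positivity of the second fundamental form with respect to `normal` (which
forces `X t` to be an immersion and `normal` to be the outer normal). The time derivative at the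
instant `t₀` of any curvature quantity depends on the family only through the surface and its
velocity at that instant, so the flow equation is imposed at that instant. A solution of the flow
satisfies this at each of its instants. -/
structure IsFlowAt (F : Mat2 → Mat2 → ℝ) (W : Set (ℝ × Param)) (X : ℝ → Param → Space)
    (t₀ : ℝ) : Prop where
  isOpen : IsOpen W
  smooth : ContDiffOn ℝ ∞ (fun z : ℝ × Param => X z.1 z.2) W
  strictlyConvex : ∀ z ∈ W, (secondForm (X z.1) z.2).PosDef
  flow : ∀ x, (t₀, x) ∈ W →
    HasDerivAt (fun t => X t x)
      (-(F (secondForm (X t₀) x) (metric (X t₀) x) • normal (X t₀) x)) t₀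

/-! ### Maximum-principle functions -/

/-- The value `p(a, b) / q(a, b)`. -/
noncomputable def ratio (p q : MvPolynomial (Fin 2) ℝ) (a b : ℝ) : ℝ :=
  MvPolynomial.eval ![a, b] p / MvPolynomial.eval ![a, b] q

/-- The function `w = p(λ₁, λ₂) / q(λ₁, λ₂)` of the principal curvatures, on a surface patch. -/
noncomputable def surfaceW (p q : MvPolynomial (Fin 2) ℝ) (X : Param → Space) (x : Param) : ℝ :=
  ratio p q (kappaMax (secondForm X x) (metric X x)) (kappaMin (secondForm X x) (metric X x))

/-- `L(w) = dw/dt - F^{ij} w_{;ij}` at the point `x` and the instant `t`. -/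
noncomputable def evolutionOp (F : Mat2 → Mat2 → ℝ) (p q : MvPolynomial (Fin 2) ℝ)
    (X : ℝ → Param → Space) (t : ℝ) (x : Param) : ℝ :=
  deriv (fun s => surfaceW p q (X s) x) t
    - ∑ i, ∑ j, velocityDeriv F (secondForm (X t) x) (metric (X t) x) i j
        * covHess (X t) (surfaceW p q (X t)) i j x

/-- All `h_{ij;k}` vanish at the point `x`. -/
def CovSecondFormVanishes (X : Param → Space) (x : Param) : Prop :=
  ∀ i j k, covSecondForm X i j k x = 0

/-- `x` is a critical point of `w`: `w_{;i} = 0` for `i = 1, 2`. -/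
def IsCriticalPoint (p q : MvPolynomial (Fin 2) ℝ) (X : Param → Space) (x : Param) : Prop :=
  ∀ i, pd i (surfaceW p q X) x = 0

/-- The principal curvatures of `X` at `x` are those of `Y` at `y`. -/
def SamePrincipalCurvatures (X : Param → Space) (x : Param) (Y : Param → Space) (y : Param) :
    Prop :=
  kappaMax (secondForm X x) (metric X x) = kappaMax (secondForm Y y) (metric Y y) ∧
    kappaMin (secondForm X x) (metric X x) = kappaMin (secondForm Y y) (metric Y y)

/-- `w = p/q` is a maximum-principle function for the normal velocity `F`.

The terms of `L(w)` without derivatives of `(h_{ij})` at given principal curvatures are the value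
that `L(w)` takes at points with these principal curvatures where all `h_{ij;k}` vanish; the terms
involving derivatives of `(h_{ij})` are the rest, i.e. the difference between `L(w)` and that
value. -/
structure IsMaximumPrincipleFunction (F : Mat2 → Mat2 → ℝ) (p q : MvPolynomial (Fin 2) ℝ) :
    Prop where
  p_ne_zero : p ≠ 0
  q_ne_zero : q ≠ 0
  p_homogeneous : p.IsHomogeneous p.totalDegree
  q_homogeneous : q.IsHomogeneous q.totalDegree
  /-- The rational function `p/q` is symmetric: `p(x,y)/q(x,y) = p(y,x)/q(y,x)`. -/
  symmetric : p * MvPolynomial.rename (Equiv.swap 0 1) q =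
    MvPolynomial.rename (Equiv.swap 0 1) p * q
  p_nonneg : ∀ a b : ℝ, 0 < a → 0 < b → 0 ≤ MvPolynomial.eval ![a, b] p
  q_pos : ∀ a b : ℝ, 0 < a → 0 < b → 0 < MvPolynomial.eval ![a, b] q
  p_umbilic : ∀ a : ℝ, 0 < a → MvPolynomial.eval ![a, a] p = 0
  degree_lt : q.totalDegree < p.totalDegree
  decreasing : ∀ ρ : ℝ, 0 < ρ → ρ < 1 → deriv (fun r => ratio p q r 1) ρ < 0
  increasing : ∀ ρ : ℝ, 1 < ρ → 0 < deriv (fun r => ratio p q r 1) ρ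
  /-- The terms of `L(w)` without derivatives of `(h_{ij})` are nonpositive. -/
  constant_terms : ∀ (W : Set (ℝ × Param)) (X : ℝ → Param → Space) (t : ℝ) (x : Param),
    IsFlowAt F W X t → (t, x) ∈ W → CovSecondFormVanishes (X t) x →
      evolutionOp F p q X t x ≤ 0
  /-- The terms of `L(w)` involving derivatives of `(h_{ij})` are nonpositive at critical points
  of `w`. -/
  gradient_terms : ∀ (W W' : Set (ℝ × Param)) (X Y : ℝ → Param → Space) (t s : ℝ) (x y : Param),
    IsFlowAt F W X t → (t, x) ∈ W → IsCriticalPoint p q (X t) x →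
    IsFlowAt F W' Y s → (s, y) ∈ W' → CovSecondFormVanishes (Y s) y →
    SamePrincipalCurvatures (X t) x (Y s) y →
      evolutionOp F p q X t x - evolutionOp F p q Y s y ≤ 0

end MPF

/-! Condition (IV)(b) fails where one principal curvature is much larger than the other, and
surfaces of revolution suffice to see this. Normalize the curvatures to (x, 1) with x > 1, and put
v(x) = w(x, 1) and d = deg p - deg q, so that w(a, b) = b^d v(a/b). Two surfaces with these
curvatures are compared. On one of them the point lies on the equator and all h_{ij;k} vanish there.
On the other it lies off the equator, and the rate of change of the radius of curvature of the
profile is tuned so that w is critical. The difference of the two values of L(w) is a positive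
multiple of `gradientTerms`, an expression in σ, d, x and v, v', v'' at x. Hence (IV)(b) makes this
expression nonpositive for every x > 1 (`IsMaximumPrincipleFunction.gradientTerms_nonpos`).

As x → ∞ the function v grows like x^m with m = deg p(X, 1) - deg q(X, 1), so x v'/v → m and x²
v''/v → m(m - 1) (`tendsto_logDeriv_quot`, `tendsto_logDeriv₂_quot`). Therefore x²/v³ times
`gradientTerms` tends to m((σ - 1)(2m - d)² + (2m - d)(m - d)). Symmetry and homogeneity give v(x) =
x^d v(1/x), and (III) keeps v(1/x) away from 0, whence m ≥ d
(`IsMaximumPrincipleFunction.degree_le`), while d ≥ 1 by (II). The limit is thus positive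
(`eventually_gradientTerms_pos`), a contradiction. If m = d, only the term with the factor σ - 1
survives; this is where σ > 1 is decisive. -/

namespace MPF

/-! ### Partial derivatives in rotating frames -/

theorem pd_congr {E : Type*} [NormedAddCommGroup E] [NormedSpace ℝ E] {f g : Param → E}
    {x : Param} (i : Fin 2) (h : f =ᶠ[nhds x] g) : pd i f x = pd i g x := by
  rw [pd, pd, h.fderiv_eq]

theorem hasFDerivAt_coord {a : ℝ → ℝ} {a' : ℝ} {i : Fin 2} {y : Param}
    (h : HasDerivAt a a' (y i)) :
    HasFDerivAt (fun y : Param => a (y i))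
      (a' • ContinuousLinearMap.proj (R := ℝ) (φ := fun _ : Fin 2 => ℝ) i) y :=
  h.comp_hasFDerivAt y (ContinuousLinearMap.proj (R := ℝ) (φ := fun _ : Fin 2 => ℝ) i).hasFDerivAt

theorem pd_zero_coord {a : ℝ → ℝ} {a' : ℝ} {y : Param} (h : HasDerivAt a a' (y 0)) :
    pd 0 (fun y : Param => a (y 0)) y = a' := by
  simp [pd, (hasFDerivAt_coord h).fderiv]

theorem pd_one_coord {a : ℝ → ℝ} {a' : ℝ} {y : Param} (h : HasDerivAt a a' (y 0)) :
    pd 1 (fun y : Param => a (y 0)) y = 0 := by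
  simp [pd, (hasFDerivAt_coord h).fderiv]

/-- The vector with components `a, b, c` in the cylindrical frame at the angle `θ`. -/
noncomputable def cyl (θ a b c : ℝ) : Space :=
  ![a * Real.cos θ - b * Real.sin θ, a * Real.sin θ + b * Real.cos θ, c]

theorem cyl_dotProduct (θ a b c a' b' c' : ℝ) :
    cyl θ a b c ⬝ᵥ cyl θ a' b' c' = a * a' + b * b' + c * c' := by
  simp only [cyl, dotProduct, Fin.sum_univ_three, Matrix.cons_val_zero, Matrix.cons_val_one,
    Matrix.cons_val]
  linear_combination (a * a' + b * b') * Real.sin_sq_add_cos_sq θ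

theorem cyl_cross (θ a b c a' b' c' : ℝ) :
    crossProduct (cyl θ a b c) (cyl θ a' b' c') =
      cyl θ (b * c' - c * b') (c * a' - a * c') (a * b' - b * a') := by
  rw [cross_apply]
  ext i
  fin_cases i
  · simp [cyl]; ring
  · simp [cyl]; ring
  · simp [cyl]
    linear_combination (a * b' - b * a') * Real.sin_sq_add_cos_sq θ

theorem smul_cyl (k θ a b c : ℝ) : k • cyl θ a b c = cyl θ (k * a) (k * b) (k * c) := by
  ext i
  fin_cases i <;> simp [cyl] <;> ring

theorem hasFDerivAt_vec3 {f₀ f₁ f₂ : Param → ℝ} {L₀ L₁ L₂ : Param →L[ℝ] ℝ} {y : Param}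
    (h₀ : HasFDerivAt f₀ L₀ y) (h₁ : HasFDerivAt f₁ L₁ y) (h₂ : HasFDerivAt f₂ L₂ y) :
    HasFDerivAt (fun y => (![f₀ y, f₁ y, f₂ y] : Space))
      (ContinuousLinearMap.pi ![L₀, L₁, L₂]) y := by
  refine hasFDerivAt_pi.2 fun i => ?_
  fin_cases i
  exacts [h₀, h₁, h₂]

/-- Differentiation in the angle turns the horizontal components through a right angle. All partial
derivatives of a surface of revolution therefore stay in the rotating frame, where scalar and vector
products involve no trigonometric functions. -/
theorem hasFDerivAt_cyl {a b c : ℝ → ℝ} {a' b' c' : ℝ} {y : Param}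
    (ha : HasDerivAt a a' (y 0)) (hb : HasDerivAt b b' (y 0)) (hc : HasDerivAt c c' (y 0)) :
    ∃ L : Param →L[ℝ] Space,
      HasFDerivAt (fun y : Param => cyl (y 1) (a (y 0)) (b (y 0)) (c (y 0))) L y ∧
      L (Pi.single 0 1) = cyl (y 1) a' b' c' ∧
      L (Pi.single 1 1) = cyl (y 1) (-b (y 0)) (a (y 0)) 0 := by
  have hcos := hasFDerivAt_coord (i := 1) (y := y) (Real.hasDerivAt_cos (y 1))
  have hsin := hasFDerivAt_coord (i := 1) (y := y) (Real.hasDerivAt_sin (y 1))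
  have Ha := hasFDerivAt_coord ha
  have Hb := hasFDerivAt_coord hb
  have Hc := hasFDerivAt_coord hc
  have h0 := (Ha.mul hcos).sub (Hb.mul hsin)
  have h1 := (Ha.mul hsin).add (Hb.mul hcos)
  refine ⟨_, hasFDerivAt_vec3 h0 h1 Hc, ?_, ?_⟩
  · ext i
    fin_cases i <;> simp [cyl] <;> ring
  · ext i
    fin_cases i <;> simp [cyl] <;> ring

theorem pd_zero_cyl {a b c : ℝ → ℝ} {a' b' c' : ℝ} {y : Param}
    (ha : HasDerivAt a a' (y 0)) (hb : HasDerivAt b b' (y 0)) (hc : HasDerivAt c c' (y 0)) :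
    pd 0 (fun y : Param => cyl (y 1) (a (y 0)) (b (y 0)) (c (y 0))) y = cyl (y 1) a' b' c' := by
  obtain ⟨L, hL, h0, -⟩ := hasFDerivAt_cyl ha hb hc
  rw [pd, hL.fderiv, h0]

theorem pd_one_cyl {a b c : ℝ → ℝ} {a' b' c' : ℝ} {y : Param}
    (ha : HasDerivAt a a' (y 0)) (hb : HasDerivAt b b' (y 0)) (hc : HasDerivAt c c' (y 0)) :
    pd 1 (fun y : Param => cyl (y 1) (a (y 0)) (b (y 0)) (c (y 0))) y =
      cyl (y 1) (-b (y 0)) (a (y 0)) 0 := by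
  obtain ⟨L, hL, -, h1⟩ := hasFDerivAt_cyl ha hb hc
  rw [pd, hL.fderiv, h1]

/-! ### Surfaces of revolution -/

/-- The surface of revolution with profile curve `(R, -Z)`. -/
noncomputable def revolution (R Z : ℝ → ℝ) (y : Param) : Space :=
  cyl (y 1) (R (y 0)) 0 (-Z (y 0))

/-- `R₁, R₂` and `Z₁, Z₂` are the first two derivatives of `R` and `Z` on the open set `U`. -/
structure ProfileOn (U : Set ℝ) (R R₁ R₂ Z Z₁ Z₂ : ℝ → ℝ) : Prop where
  isOpen : IsOpen U
  R_deriv : ∀ u ∈ U, HasDerivAt R (R₁ u) u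
  R_deriv₂ : ∀ u ∈ U, HasDerivAt R₁ (R₂ u) u
  Z_deriv : ∀ u ∈ U, HasDerivAt Z (Z₁ u) u
  Z_deriv₂ : ∀ u ∈ U, HasDerivAt Z₁ (Z₂ u) u

theorem eventually_coord_mem {U : Set ℝ} (hU : IsOpen U) {y : Param} (hy : y 0 ∈ U) :
    ∀ᶠ x : Param in nhds y, x 0 ∈ U :=
  (continuous_apply 0).continuousAt.eventually_mem (hU.mem_nhds hy)

section Revolution

variable {U : Set ℝ} {R R₁ R₂ Z Z₁ Z₂ : ℝ → ℝ}

theorem pd_zero_revolution (H : ProfileOn U R R₁ R₂ Z Z₁ Z₂) {y : Param} (hy : y 0 ∈ U) :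
    pd 0 (revolution R Z) y = cyl (y 1) (R₁ (y 0)) 0 (-Z₁ (y 0)) :=
  pd_zero_cyl (H.R_deriv _ hy) (hasDerivAt_const _ 0) (H.Z_deriv _ hy).neg

theorem pd_one_revolution (H : ProfileOn U R R₁ R₂ Z Z₁ Z₂) {y : Param} (hy : y 0 ∈ U) :
    pd 1 (revolution R Z) y = cyl (y 1) 0 (R (y 0)) 0 := by
  have := pd_one_cyl (H.R_deriv _ hy) (hasDerivAt_const _ 0) (H.Z_deriv _ hy).neg
  rw [neg_zero] at this
  exact this

theorem pd_zero_zero_revolution (H : ProfileOn U R R₁ R₂ Z Z₁ Z₂) {y : Param} (hy : y 0 ∈ U) :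
    pd 0 (pd 0 (revolution R Z)) y = cyl (y 1) (R₂ (y 0)) 0 (-Z₂ (y 0)) := by
  rw [pd_congr 0 ((eventually_coord_mem H.isOpen hy).mono fun x hx => pd_zero_revolution H hx)]
  exact pd_zero_cyl (H.R_deriv₂ _ hy) (hasDerivAt_const _ 0) (H.Z_deriv₂ _ hy).neg

theorem pd_one_zero_revolution (H : ProfileOn U R R₁ R₂ Z Z₁ Z₂) {y : Param} (hy : y 0 ∈ U) :
    pd 1 (pd 0 (revolution R Z)) y = cyl (y 1) 0 (R₁ (y 0)) 0 := by
  rw [pd_congr 1 ((eventually_coord_mem H.isOpen hy).mono fun x hx => pd_zero_revolution H hx)]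
  have := pd_one_cyl (H.R_deriv₂ _ hy) (hasDerivAt_const _ 0) (H.Z_deriv₂ _ hy).neg
  rw [neg_zero] at this
  exact this

theorem pd_zero_one_revolution (H : ProfileOn U R R₁ R₂ Z Z₁ Z₂) {y : Param} (hy : y 0 ∈ U) :
    pd 0 (pd 1 (revolution R Z)) y = cyl (y 1) 0 (R₁ (y 0)) 0 := by
  rw [pd_congr 0 ((eventually_coord_mem H.isOpen hy).mono fun x hx => pd_one_revolution H hx)]
  exact pd_zero_cyl (hasDerivAt_const _ 0) (H.R_deriv _ hy) (hasDerivAt_const _ 0)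

theorem pd_one_one_revolution (H : ProfileOn U R R₁ R₂ Z Z₁ Z₂) {y : Param} (hy : y 0 ∈ U) :
    pd 1 (pd 1 (revolution R Z)) y = cyl (y 1) (-R (y 0)) 0 0 := by
  rw [pd_congr 1 ((eventually_coord_mem H.isOpen hy).mono fun x hx => pd_one_revolution H hx)]
  exact pd_one_cyl (hasDerivAt_const _ 0) (H.R_deriv _ hy) (hasDerivAt_const _ 0)

theorem metric_revolution (H : ProfileOn U R R₁ R₂ Z Z₁ Z₂) {y : Param} (hy : y 0 ∈ U) :
    metric (revolution R Z) y =
      Matrix.diagonal ![R₁ (y 0) ^ 2 + Z₁ (y 0) ^ 2, R (y 0) ^ 2] := by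
  ext i j
  fin_cases i <;> fin_cases j <;>
    simp [metric, pd_zero_revolution H hy, pd_one_revolution H hy, cyl_dotProduct] <;> ring

/-- The minus sign in the profile (R, -Z) makes the vector product point away from the axis where Z₁
> 0. -/
theorem normal_revolution (H : ProfileOn U R R₁ R₂ Z Z₁ Z₂) {y : Param} (hy : y 0 ∈ U)
    (hR : 0 < R (y 0)) :
    normal (revolution R Z) y =
      cyl (y 1) (Z₁ (y 0) / √(R₁ (y 0) ^ 2 + Z₁ (y 0) ^ 2)) 0
        (R₁ (y 0) / √(R₁ (y 0) ^ 2 + Z₁ (y 0) ^ 2)) := by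
  have hc : crossNormal (revolution R Z) y =
      cyl (y 1) (R (y 0) * Z₁ (y 0)) 0 (R (y 0) * R₁ (y 0)) := by
    rw [crossNormal, pd_zero_revolution H hy, pd_one_revolution H hy, cyl_cross]
    congr 1 <;> ring
  have hs : crossNormal (revolution R Z) y ⬝ᵥ crossNormal (revolution R Z) y =
      R (y 0) ^ 2 * (R₁ (y 0) ^ 2 + Z₁ (y 0) ^ 2) := by
    rw [hc, cyl_dotProduct]; ring
  rw [normal, hs, Real.sqrt_mul (sq_nonneg _), Real.sqrt_sq hR.le, hc, smul_cyl]
  congr 1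
  · field_simp
  · ring
  · field_simp

theorem secondForm_revolution (H : ProfileOn U R R₁ R₂ Z Z₁ Z₂) {y : Param} (hy : y 0 ∈ U)
    (hR : 0 < R (y 0)) :
    secondForm (revolution R Z) y =
      Matrix.diagonal ![(Z₂ (y 0) * R₁ (y 0) - R₂ (y 0) * Z₁ (y 0)) /
          √(R₁ (y 0) ^ 2 + Z₁ (y 0) ^ 2),
        R (y 0) * Z₁ (y 0) / √(R₁ (y 0) ^ 2 + Z₁ (y 0) ^ 2)] := by
  ext i j
  fin_cases i <;> fin_cases j <;>
    simp [secondForm, pd_zero_zero_revolution H hy, pd_one_zero_revolution H hy,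
      pd_zero_one_revolution H hy, pd_one_one_revolution H hy, normal_revolution H hy hR,
      cyl_dotProduct] <;> ring

end Revolution

/-! ### Diagonal fundamental forms -/

theorem meanCurv_diagonal (h₁ h₂ g₁ g₂ : ℝ) (hg₁ : 0 < g₁) (hg₂ : 0 < g₂) :
    meanCurv (Matrix.diagonal ![h₁, h₂]) (Matrix.diagonal ![g₁, g₂]) = h₁ / g₁ + h₂ / g₂ := by
  simp only [meanCurv, Matrix.inv_def, Matrix.adjugate_fin_two, Ring.inverse_eq_inv',
    Matrix.trace_fin_two, Matrix.smul_mul, Matrix.smul_apply, Matrix.mul_apply,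
    Fin.sum_univ_two, Matrix.of_apply, Matrix.cons_val', Matrix.cons_val_zero,
    Matrix.cons_val_one, smul_eq_mul, Matrix.det_fin_two]
  simp [Matrix.diagonal]
  field_simp

theorem gaussCurv_diagonal (h₁ h₂ g₁ g₂ : ℝ) :
    gaussCurv (Matrix.diagonal ![h₁, h₂]) (Matrix.diagonal ![g₁, g₂]) =
      h₁ * h₂ / (g₁ * g₂) := by
  simp [gaussCurv, Matrix.det_diagonal]

theorem discrim_diagonal (h₁ h₂ g₁ g₂ : ℝ) (hg₁ : 0 < g₁) (hg₂ : 0 < g₂)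
    (hle : h₂ / g₂ ≤ h₁ / g₁) :
    √(meanCurv (Matrix.diagonal ![h₁, h₂]) (Matrix.diagonal ![g₁, g₂]) ^ 2 -
      4 * gaussCurv (Matrix.diagonal ![h₁, h₂]) (Matrix.diagonal ![g₁, g₂])) =
      h₁ / g₁ - h₂ / g₂ := by
  rw [meanCurv_diagonal _ _ _ _ hg₁ hg₂, gaussCurv_diagonal, ← Real.sqrt_sq (sub_nonneg.2 hle)]
  congr 1
  field_simp
  ring

theorem kappaMax_diagonal (h₁ h₂ g₁ g₂ : ℝ) (hg₁ : 0 < g₁) (hg₂ : 0 < g₂)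
    (hle : h₂ / g₂ ≤ h₁ / g₁) :
    kappaMax (Matrix.diagonal ![h₁, h₂]) (Matrix.diagonal ![g₁, g₂]) = h₁ / g₁ := by
  rw [kappaMax, discrim_diagonal _ _ _ _ hg₁ hg₂ hle, meanCurv_diagonal _ _ _ _ hg₁ hg₂]
  ring

theorem kappaMin_diagonal (h₁ h₂ g₁ g₂ : ℝ) (hg₁ : 0 < g₁) (hg₂ : 0 < g₂)
    (hle : h₂ / g₂ ≤ h₁ / g₁) :
    kappaMin (Matrix.diagonal ![h₁, h₂]) (Matrix.diagonal ![g₁, g₂]) = h₂ / g₂ := by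
  rw [kappaMin, discrim_diagonal _ _ _ _ hg₁ hg₂ hle, meanCurv_diagonal _ _ _ _ hg₁ hg₂]
  ring

theorem velocityDeriv_gaussPower_diagonal {σ h₁ h₂ g₁ g₂ : ℝ} (hh₁ : 0 < h₁) (hh₂ : 0 < h₂)
    (hg₁ : 0 < g₁) (hg₂ : 0 < g₂) :
    velocityDeriv (gaussPower σ) (Matrix.diagonal ![h₁, h₂]) (Matrix.diagonal ![g₁, g₂]) 0 0 =
      σ * (h₁ * h₂ / (g₁ * g₂)) ^ σ / h₁ := by
  have e : ∀ s : ℝ, gaussPower σ (Matrix.diagonal ![h₁, h₂] + s • Matrix.single 0 0 1)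
      (Matrix.diagonal ![g₁, g₂]) = ((h₁ + s) * h₂ / (g₁ * g₂)) ^ σ := by
    intro s
    simp [gaussPower, gaussCurv, Matrix.det_fin_two]
  rw [velocityDeriv, funext e]
  have h1 : HasDerivAt (fun s : ℝ => (h₁ + s) * h₂ / (g₁ * g₂)) (1 * h₂ / (g₁ * g₂)) 0 :=
    (((hasDerivAt_id' (0 : ℝ)).const_add h₁).mul_const h₂).div_const _
  have hK : 0 < h₁ * h₂ / (g₁ * g₂) := by positivity
  have h2 := h1.rpow_const (p := σ) (Or.inl (by simpa using hK.ne'))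
  rw [h2.deriv, add_zero, Real.rpow_sub_one hK.ne']
  field_simp

/-- Changing a single off-diagonal entry of a diagonal matrix does not change its determinant. -/
theorem velocityDeriv_gaussPower_diagonal_of_ne {σ h₁ h₂ g₁ g₂ : ℝ} {i j : Fin 2} (hij : i ≠ j) :
    velocityDeriv (gaussPower σ) (Matrix.diagonal ![h₁, h₂]) (Matrix.diagonal ![g₁, g₂]) i j =
      0 := by
  have e : ∀ s : ℝ, gaussPower σ (Matrix.diagonal ![h₁, h₂] + s • Matrix.single i j 1)
      (Matrix.diagonal ![g₁, g₂]) = (h₁ * h₂ / (g₁ * g₂)) ^ σ := by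
    intro s
    fin_cases i <;> fin_cases j <;> simp_all [gaussPower, gaussCurv, Matrix.det_fin_two]
  rw [velocityDeriv, funext e, deriv_const]

/-! ### A family of surfaces of revolution moving by a power of the Gauss curvature -/

/-- Parameters of a profile curve, parametrized by its normal angle `u`, whose radius of curvature
is `A + B (u - φ)`. -/
structure Cap where
  A : ℝ
  B : ℝ
  C : ℝ
  φ : ℝ
  σ : ℝ

namespace Cap

variable (P : Cap)

/-- The radius of curvature of the profile curve. -/
noncomputable def rho (u : ℝ) : ℝ := P.A + P.B * (u - P.φ)

/-- The distance to the axis. -/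
noncomputable def rad (u : ℝ) : ℝ := P.C + P.rho u * Real.cos u - P.B * Real.sin u

/-- The terms with B cancel on differentiation, so the curve (`rad`, -`height`) has velocity ρ(u)
(-sin u, -cos u). Its normal is (cos u, -sin u), which makes u the normal angle. The constant C in
`rad` stays free to prescribe the distance to the axis, and the slope B prescribes the derivative of
the curvature. Second derivatives of the curvatures cancel in the non-constant part of L(w), so an
affine radius of curvature is general enough. -/
noncomputable def height (u : ℝ) : ℝ := P.rho u * Real.sin u + P.B * Real.cos u

/-- The principal curvature in the direction of the profile, with its first two derivatives. -/
noncomputable def k₁ (u : ℝ) : ℝ := 1 / P.rho u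

noncomputable def dk₁ (u : ℝ) : ℝ := -P.B / P.rho u ^ 2

noncomputable def ddk₁ (u : ℝ) : ℝ := 2 * P.B ^ 2 / P.rho u ^ 3

/-- The principal curvature in the direction of the rotation, with its first two derivatives. -/
noncomputable def k₂ (u : ℝ) : ℝ := Real.cos u / P.rad u

noncomputable def dk₂ (u : ℝ) : ℝ := Real.sin u / P.rad u * (P.rho u * P.k₂ u - 1)

noncomputable def ddk₂ (u : ℝ) : ℝ :=
  (P.k₂ u + P.rho u * (Real.sin u / P.rad u) ^ 2) * (P.rho u * P.k₂ u - 1) +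
    Real.sin u / P.rad u * (P.B * P.k₂ u + P.rho u * P.dk₂ u)

/-- The normal velocity `K ^ σ`, with its first two derivatives. -/
noncomputable def speed (u : ℝ) : ℝ := (P.k₁ u * P.k₂ u) ^ P.σ

noncomputable def dspeed (u : ℝ) : ℝ :=
  P.speed u * (P.σ * (P.dk₁ u / P.k₁ u + P.dk₂ u / P.k₂ u))

noncomputable def ddspeed (u : ℝ) : ℝ :=
  P.dspeed u * (P.σ * (P.dk₁ u / P.k₁ u + P.dk₂ u / P.k₂ u)) +
    P.speed u * (P.σ * ((P.ddk₁ u * P.k₁ u - P.dk₁ u * P.dk₁ u) / P.k₁ u ^ 2 +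
      (P.ddk₂ u * P.k₂ u - P.dk₂ u * P.dk₂ u) / P.k₂ u ^ 2))

def domain : Set ℝ := {u | 0 < P.rho u ∧ 0 < P.rad u ∧ 0 < Real.cos u}

theorem hasDerivAt_rho (u : ℝ) : HasDerivAt P.rho P.B u := by
  have := (((hasDerivAt_id' u).sub_const P.φ).const_mul P.B).const_add P.A
  rwa [mul_one] at this

theorem hasDerivAt_rad (u : ℝ) : HasDerivAt P.rad (-(P.rho u * Real.sin u)) u := by
  have := ((((P.hasDerivAt_rho u).mul (Real.hasDerivAt_cos u)).const_add P.C).sub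
    ((Real.hasDerivAt_sin u).const_mul P.B))
  refine (this.congr_deriv ?_).congr_of_eventuallyEq (.of_forall fun v => ?_)
  · ring
  · simp [rad]

theorem hasDerivAt_height (u : ℝ) : HasDerivAt P.height (P.rho u * Real.cos u) u := by
  have := ((P.hasDerivAt_rho u).mul (Real.hasDerivAt_sin u)).add
    ((Real.hasDerivAt_cos u).const_mul P.B)
  exact this.congr_deriv (by ring)

theorem isOpen_domain : IsOpen P.domain := by
  have h1 : Continuous P.rho :=
    continuous_iff_continuousAt.2 fun u => (P.hasDerivAt_rho u).continuousAt
  have h2 : Continuous P.rad :=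
    continuous_iff_continuousAt.2 fun u => (P.hasDerivAt_rad u).continuousAt
  exact (isOpen_lt continuous_const h1).inter
    ((isOpen_lt continuous_const h2).inter (isOpen_lt continuous_const Real.continuous_cos))

variable {P} {u : ℝ}

theorem k₁_pos (hu : u ∈ P.domain) : 0 < P.k₁ u := one_div_pos.2 hu.1

theorem k₂_pos (hu : u ∈ P.domain) : 0 < P.k₂ u := div_pos hu.2.2 hu.2.1

theorem hasDerivAt_k₁ (hu : u ∈ P.domain) : HasDerivAt P.k₁ (P.dk₁ u) u := by
  have h := hu.1.ne'
  refine ((hasDerivAt_const u (1 : ℝ)).div (P.hasDerivAt_rho u) h).congr_deriv ?_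
  rw [dk₁]; ring

theorem hasDerivAt_dk₁ (hu : u ∈ P.domain) : HasDerivAt P.dk₁ (P.ddk₁ u) u := by
  have h := hu.1.ne'
  refine ((hasDerivAt_const u (-P.B)).div ((P.hasDerivAt_rho u).pow 2)
    (pow_ne_zero 2 h)).congr_deriv ?_
  simp only [ddk₁, Pi.pow_apply]
  field_simp
  simp
  ring

theorem hasDerivAt_k₂ (hu : u ∈ P.domain) : HasDerivAt P.k₂ (P.dk₂ u) u := by
  have h := hu.2.1.ne'
  refine ((Real.hasDerivAt_cos u).div (P.hasDerivAt_rad u) h).congr_deriv ?_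
  simp only [dk₂, k₂]
  field_simp
  ring

theorem hasDerivAt_dk₂ (hu : u ∈ P.domain) : HasDerivAt P.dk₂ (P.ddk₂ u) u := by
  have h := hu.2.1.ne'
  have h1 := ((Real.hasDerivAt_sin u).div (P.hasDerivAt_rad u) h).mul
    (((P.hasDerivAt_rho u).mul (hasDerivAt_k₂ hu)).sub_const 1)
  refine h1.congr_deriv ?_
  simp only [ddk₂, Pi.mul_apply, Pi.div_apply]
  have e : (Real.cos u * P.rad u - Real.sin u * -(P.rho u * Real.sin u)) / P.rad u ^ 2 =
      P.k₂ u + P.rho u * (Real.sin u / P.rad u) ^ 2 := by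
    rw [k₂]; field_simp; ring
  rw [e]

theorem hasDerivAt_speed (hu : u ∈ P.domain) : HasDerivAt P.speed (P.dspeed u) u := by
  have h1 := k₁_pos hu
  have h2 := k₂_pos hu
  have hK : P.k₁ u * P.k₂ u ≠ 0 := (mul_pos h1 h2).ne'
  refine (((hasDerivAt_k₁ hu).mul (hasDerivAt_k₂ hu)).rpow_const (p := P.σ)
    (Or.inl hK)).congr_deriv ?_
  simp only [dspeed, speed, Pi.mul_apply]
  rw [Real.rpow_sub_one hK]
  field_simp

theorem hasDerivAt_dspeed (hu : u ∈ P.domain) : HasDerivAt P.dspeed (P.ddspeed u) u :=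
  (hasDerivAt_speed hu).mul ((((hasDerivAt_dk₁ hu).div (hasDerivAt_k₁ hu) (k₁_pos hu).ne').add
    ((hasDerivAt_dk₂ hu).div (hasDerivAt_k₂ hu) (k₂_pos hu).ne')).const_mul P.σ)

/-- Serves the openness of `region`, where the condition on `turn` involves `ddspeed`. -/
theorem continuousAt_ddspeed (hu : u ∈ P.domain) : ContinuousAt P.ddspeed u := by
  have c1 := (hasDerivAt_k₁ hu).continuousAt
  have c2 := (hasDerivAt_k₂ hu).continuousAt
  have c3 := (hasDerivAt_dk₁ hu).continuousAt
  have c4 := (hasDerivAt_dk₂ hu).continuousAt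
  have c5 := (hasDerivAt_speed hu).continuousAt
  have c6 := (hasDerivAt_dspeed hu).continuousAt
  have c7 := (P.hasDerivAt_rho u).continuousAt
  have c8 := (P.hasDerivAt_rad u).continuousAt
  have n1 := (k₁_pos hu).ne'
  have n2 := (k₂_pos hu).ne'
  have n3 := hu.1.ne'
  have n4 := hu.2.1.ne'
  have c9 : ContinuousAt P.ddk₁ u := by
    unfold ddk₁
    exact continuousAt_const.div (c7.pow 3) (pow_ne_zero 3 n3)
  have c11 : ContinuousAt (fun u => Real.sin u / P.rad u) u :=
    Real.continuous_sin.continuousAt.div c8 n4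
  have c10 : ContinuousAt P.ddk₂ u := by
    unfold ddk₂
    fun_prop
  have c12 : ContinuousAt (fun u => P.dk₁ u / P.k₁ u) u := c3.div c1 n1
  have c13 : ContinuousAt (fun u => P.dk₂ u / P.k₂ u) u := c4.div c2 n2
  have c14 : ContinuousAt (fun u => (P.ddk₁ u * P.k₁ u - P.dk₁ u * P.dk₁ u) / P.k₁ u ^ 2) u :=
    ContinuousAt.div (by fun_prop) (by fun_prop) (pow_ne_zero 2 n1)
  have c15 : ContinuousAt (fun u => (P.ddk₂ u * P.k₂ u - P.dk₂ u * P.dk₂ u) / P.k₂ u ^ 2) u :=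
    ContinuousAt.div (by fun_prop) (by fun_prop) (pow_ne_zero 2 n2)
  unfold ddspeed
  fun_prop

/-! ### Motion of the cap along its normals, linear in time. -/

variable (P)

/-- The profile curve at the time `t`, with its first two derivatives. -/
noncomputable def R (t u : ℝ) : ℝ := P.rad u - t * (P.speed u * Real.cos u)

noncomputable def dR (t u : ℝ) : ℝ :=
  -(P.rho u * Real.sin u) - t * (P.dspeed u * Real.cos u - P.speed u * Real.sin u)

noncomputable def ddR (t u : ℝ) : ℝ :=
  -(P.B * Real.sin u + P.rho u * Real.cos u) -
    t * (P.ddspeed u * Real.cos u - 2 * P.dspeed u * Real.sin u - P.speed u * Real.cos u)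

noncomputable def Z (t u : ℝ) : ℝ := P.height u - t * (P.speed u * Real.sin u)

noncomputable def dZ (t u : ℝ) : ℝ :=
  P.rho u * Real.cos u - t * (P.dspeed u * Real.sin u + P.speed u * Real.cos u)

noncomputable def ddZ (t u : ℝ) : ℝ :=
  P.B * Real.cos u - P.rho u * Real.sin u -
    t * (P.ddspeed u * Real.sin u + 2 * P.dspeed u * Real.cos u - P.speed u * Real.sin u)

/-- The numerator of the curvature of the profile curve. -/
noncomputable def turn (t u : ℝ) : ℝ := P.ddZ t u * P.dR t u - P.ddR t u * P.dZ t u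

/-- The length of the velocity of the profile curve. -/
noncomputable def len (t u : ℝ) : ℝ := √(P.dR t u ^ 2 + P.dZ t u ^ 2)

theorem profileOn (t : ℝ) :
    ProfileOn P.domain (P.R t) (P.dR t) (P.ddR t) (P.Z t) (P.dZ t) (P.ddZ t) where
  isOpen := P.isOpen_domain
  R_deriv u hu := ((P.hasDerivAt_rad u).sub
    (((hasDerivAt_speed hu).mul (Real.hasDerivAt_cos u)).const_mul t)).congr_deriv (by
      rw [dR]; ring)
  R_deriv₂ u hu := (((P.hasDerivAt_rho u).mul (Real.hasDerivAt_sin u)).neg.sub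
    ((((hasDerivAt_dspeed hu).mul (Real.hasDerivAt_cos u)).sub
      ((hasDerivAt_speed hu).mul (Real.hasDerivAt_sin u))).const_mul t)).congr_deriv (by
      rw [ddR]; ring)
  Z_deriv u hu := ((P.hasDerivAt_height u).sub
    (((hasDerivAt_speed hu).mul (Real.hasDerivAt_sin u)).const_mul t)).congr_deriv (by
      rw [dZ])
  Z_deriv₂ u hu := (((P.hasDerivAt_rho u).mul (Real.hasDerivAt_cos u)).sub
    ((((hasDerivAt_dspeed hu).mul (Real.hasDerivAt_sin u)).add
      ((hasDerivAt_speed hu).mul (Real.hasDerivAt_cos u))).const_mul t)).congr_deriv (by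
      rw [ddZ]; ring)

/-- The family of surfaces of revolution. -/
noncomputable def family (t : ℝ) : Param → Space := revolution (P.R t) (P.Z t)

/-- The space-time set on which `family` is an immersed strictly convex family. -/
def region : Set (ℝ × Param) :=
  {z | z.2 0 ∈ P.domain ∧ 0 < P.R z.1 (z.2 0) ∧ 0 < P.dZ z.1 (z.2 0) ∧
    0 < P.turn z.1 (z.2 0)}

theorem isOpen_region : IsOpen P.region := by
  rw [isOpen_iff_mem_nhds]
  rintro ⟨t, y⟩ ⟨hy, h1, h2, h3⟩
  dsimp only at hy h1 h2 h3
  have cu : ContinuousAt (fun z : ℝ × Param => z.2 0) (t, y) := by fun_prop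
  have lift : ∀ {f : ℝ → ℝ}, ContinuousAt f (y 0) →
      ContinuousAt (fun z : ℝ × Param => f (z.2 0)) (t, y) := fun hf =>
    ContinuousAt.comp (g := _) (f := fun z : ℝ × Param => z.2 0) hf cu
  have c1 := lift (hasDerivAt_speed hy).continuousAt
  have c2 := lift (hasDerivAt_dspeed hy).continuousAt
  have c3 := lift (continuousAt_ddspeed hy)
  have c4 := lift (P.hasDerivAt_rho (y 0)).continuousAt
  have c5 := lift (P.hasDerivAt_rad (y 0)).continuousAt
  have e1 : ContinuousAt (fun z : ℝ × Param => P.R z.1 (z.2 0)) (t, y) := by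
    unfold R; fun_prop
  have e2 : ContinuousAt (fun z : ℝ × Param => P.dZ z.1 (z.2 0)) (t, y) := by
    unfold dZ; fun_prop
  have e3 : ContinuousAt (fun z : ℝ × Param => P.turn z.1 (z.2 0)) (t, y) := by
    unfold turn dZ dR ddZ ddR; fun_prop
  filter_upwards [cu.eventually_mem (P.isOpen_domain.mem_nhds hy), e1.eventually_const_lt h1,
    e2.eventually_const_lt h2, e3.eventually_const_lt h3] with z a b c d
  exact ⟨a, b, c, d⟩

theorem metric_family {t : ℝ} {y : Param} (hy : y 0 ∈ P.domain) :
    metric (P.family t) y =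
      Matrix.diagonal ![P.dR t (y 0) ^ 2 + P.dZ t (y 0) ^ 2, P.R t (y 0) ^ 2] :=
  metric_revolution (P.profileOn t) hy

theorem secondForm_family {t : ℝ} {y : Param} (hy : (t, y) ∈ P.region) :
    secondForm (P.family t) y =
      Matrix.diagonal ![P.turn t (y 0) / P.len t (y 0),
        P.R t (y 0) * P.dZ t (y 0) / P.len t (y 0)] :=
  secondForm_revolution (P.profileOn t) hy.1 hy.2.1

theorem len_pos {t : ℝ} {y : Param} (hy : (t, y) ∈ P.region) : 0 < P.len t (y 0) :=
  Real.sqrt_pos.2 (by have := hy.2.2.1; positivity)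

theorem R_zero (u : ℝ) : P.R 0 u = P.rad u := by simp [R]

theorem dR_zero (u : ℝ) : P.dR 0 u = -(P.rho u * Real.sin u) := by simp [dR]

theorem dZ_zero (u : ℝ) : P.dZ 0 u = P.rho u * Real.cos u := by simp [dZ]

theorem turn_zero (u : ℝ) : P.turn 0 u = P.rho u ^ 2 := by
  simp only [turn, ddR, ddZ, dR, dZ, zero_mul, sub_zero]
  linear_combination P.rho u ^ 2 * Real.sin_sq_add_cos_sq u

theorem sq_len_zero (u : ℝ) : P.dR 0 u ^ 2 + P.dZ 0 u ^ 2 = P.rho u ^ 2 := by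
  simp only [dR, dZ, zero_mul, sub_zero]
  linear_combination P.rho u ^ 2 * Real.sin_sq_add_cos_sq u

theorem len_zero {u : ℝ} (hu : u ∈ P.domain) : P.len 0 u = P.rho u := by
  rw [len, sq_len_zero, Real.sqrt_sq hu.1.le]

theorem mem_region {y : Param} (hy : y 0 ∈ P.domain) : ((0 : ℝ), y) ∈ P.region := by
  refine ⟨hy, ?_, ?_, ?_⟩ <;> dsimp only
  · rw [R_zero]; exact hy.2.1
  · rw [dZ_zero]; exact mul_pos hy.1 hy.2.2
  · rw [turn_zero]; exact pow_pos hy.1 2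

theorem metric_family_zero {y : Param} (hy : y 0 ∈ P.domain) :
    metric (P.family 0) y = Matrix.diagonal ![P.rho (y 0) ^ 2, P.rad (y 0) ^ 2] := by
  rw [metric_family P hy, sq_len_zero, R_zero]

theorem secondForm_family_zero {y : Param} (hy : y 0 ∈ P.domain) :
    secondForm (P.family 0) y =
      Matrix.diagonal ![P.rho (y 0), P.rad (y 0) * Real.cos (y 0)] := by
  have h := hy.1.ne'
  rw [secondForm_family P (P.mem_region hy), turn_zero, len_zero P hy, R_zero, dZ_zero]
  congr 2
  · field_simp
  · congr 1; field_simp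

theorem normal_family_zero {y : Param} (hy : y 0 ∈ P.domain) :
    normal (P.family 0) y = cyl (y 1) (Real.cos (y 0)) 0 (-Real.sin (y 0)) := by
  have h := hy.1.ne'
  have hR : 0 < P.R 0 (y 0) := by rw [R_zero]; exact hy.2.1
  have := normal_revolution (P.profileOn 0) hy hR
  rw [sq_len_zero, Real.sqrt_sq hy.1.le, dR_zero, dZ_zero] at this
  rw [family, this]
  congr 1 <;> field_simp

theorem gaussPower_family_zero {y : Param} (hy : y 0 ∈ P.domain) :
    gaussPower P.σ (secondForm (P.family 0) y) (metric (P.family 0) y) = P.speed (y 0) := by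
  have h := hy.1.ne'
  have h' := hy.2.1.ne'
  rw [metric_family_zero P hy, secondForm_family_zero P hy, gaussPower, gaussCurv_diagonal, speed,
    k₁, k₂]
  congr 1
  field_simp

theorem contDiffOn_family :
    ContDiffOn ℝ ∞ (fun z : ℝ × Param => P.family z.1 z.2) P.region := by
  have cu : ContDiff ℝ ∞ (fun z : ℝ × Param => z.2 0) := by fun_prop
  have cv : ContDiff ℝ ∞ (fun z : ℝ × Param => z.2 1) := by fun_prop
  have cρ : ContDiff ℝ ∞ (fun z : ℝ × Param => P.rho (z.2 0)) := by unfold rho; fun_prop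
  have cr : ContDiff ℝ ∞ (fun z : ℝ × Param => P.rad (z.2 0)) := by
    unfold rad; fun_prop
  have cz : ContDiff ℝ ∞ (fun z : ℝ × Param => P.height (z.2 0)) := by
    unfold height; fun_prop
  have cs : ContDiffOn ℝ ∞ (fun z : ℝ × Param => P.speed (z.2 0)) P.region := by
    unfold speed k₁ k₂
    refine ContDiffOn.rpow_const_of_ne ((contDiffOn_const.div cρ.contDiffOn
      fun z hz => hz.1.1.ne').mul (ContDiffOn.div (by fun_prop) cr.contDiffOn
        fun z hz => hz.1.2.1.ne')) fun z hz => ?_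
    exact (mul_pos (k₁_pos hz.1) (k₂_pos hz.1)).ne'
  have cr' := cr.contDiffOn (s := P.region)
  have cz' := cz.contDiffOn (s := P.region)
  have t1 := (Real.contDiff_cos.comp cu).contDiffOn (s := P.region)
  have t2 := (Real.contDiff_sin.comp cu).contDiffOn (s := P.region)
  have t3 := (Real.contDiff_cos.comp cv).contDiffOn (s := P.region)
  have t4 := (Real.contDiff_sin.comp cv).contDiffOn (s := P.region)
  simp only [Function.comp_def] at t1 t2 t3 t4
  unfold family revolution cyl R Z
  refine contDiffOn_pi.2 fun i => ?_
  fin_cases i <;> simp <;> fun_prop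

/-- Each point moves on a straight line with constant velocity -K^σ ν, both taken at time 0. The
flow equation is required at that instant only, so no solution of the flow has to be constructed. -/
theorem isFlowAt : IsFlowAt (gaussPower P.σ) P.region P.family 0 where
  isOpen := P.isOpen_region
  smooth := P.contDiffOn_family
  strictlyConvex := by
    rintro ⟨t, y⟩ hz
    have hl := P.len_pos hz
    obtain ⟨-, h1, h2, h3⟩ := id hz
    dsimp only at h1 h2 h3 ⊢
    rw [secondForm_family P hz, Matrix.posDef_diagonal_iff]
    intro i
    fin_cases i
    · exact div_pos h3 hl
    · exact div_pos (mul_pos h1 h2) hl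
  flow := by
    intro y hz
    have hy := hz.1
    rw [gaussPower_family_zero P hy, normal_family_zero P hy, smul_cyl, hasDerivAt_pi]
    have key : ∀ a b : ℝ, HasDerivAt (fun t : ℝ => a - t * b) (-b) 0 := fun a b => by
      have := ((hasDerivAt_id' (0 : ℝ)).mul_const b).const_sub a
      rwa [one_mul] at this
    intro i
    fin_cases i
    · refine ((key (P.rad (y 0)) (P.speed (y 0) * Real.cos (y 0))).mul_const
        (Real.cos (y 1))).congr_deriv ?_ |>.congr_of_eventuallyEq (.of_forall fun t => ?_)
      · simp [cyl]
      · simp [family, revolution, cyl, R]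
    · refine ((key (P.rad (y 0)) (P.speed (y 0) * Real.cos (y 0))).mul_const
        (Real.sin (y 1))).congr_deriv ?_ |>.congr_of_eventuallyEq (.of_forall fun t => ?_)
      · simp [cyl]
      · simp [family, revolution, cyl, R]
    · refine ((key (P.height (y 0)) (P.speed (y 0) * Real.sin (y 0))).neg).congr_deriv ?_
        |>.congr_of_eventuallyEq (.of_forall fun t => ?_)
      · simp [cyl]
      · simp [family, revolution, cyl, Z]

end Cap

/-! ### The evolution of a homogeneous function of the principal curvatures -/

theorem hasDerivAt_pow_mul_comp {d : ℕ} {c k v : ℝ → ℝ} {c' k' v' u : ℝ}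
    (hc : HasDerivAt c c' u) (hk : HasDerivAt k k' u) (hv : HasDerivAt v v' (k u)) :
    HasDerivAt (fun u => c u ^ d * v (k u))
      (d * c u ^ (d - 1) * c' * v (k u) + c u ^ d * (v' * k')) u :=
  (hc.pow d).mul (hv.comp u hk)

/-- `ratio p q` is homogeneous of degree `d`, its restriction to the line `b = 1` is `v`, and
`v₁, v₂` are the first two derivatives of `v`. -/
structure IsHomogeneousRatio (p q : MvPolynomial (Fin 2) ℝ) (d : ℕ) (v v₁ v₂ : ℝ → ℝ) :
    Prop where
  one_le : 1 ≤ d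
  ratio_eq : ∀ a b : ℝ, 0 < a → 0 < b → ratio p q a b = b ^ d * v (a / b)
  deriv₁ : ∀ x : ℝ, 0 < x → HasDerivAt v (v₁ x) x
  deriv₂ : ∀ x : ℝ, 0 < x → HasDerivAt v₁ (v₂ x) x

namespace Cap

variable (P : Cap) {p q : MvPolynomial (Fin 2) ℝ} {d : ℕ} {v v₁ v₂ : ℝ → ℝ} {y : Param}

/-! ### Principal curvatures of the moving surface and their time derivatives. -/

noncomputable def curv₁ (t u : ℝ) : ℝ := P.turn t u / P.len t u ^ 3

noncomputable def curv₂ (t u : ℝ) : ℝ := P.dZ t u / (P.R t u * P.len t u)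

theorem kappa_family {t : ℝ} (hy : (t, y) ∈ P.region)
    (hle : P.curv₂ t (y 0) ≤ P.curv₁ t (y 0)) :
    kappaMax (secondForm (P.family t) y) (metric (P.family t) y) = P.curv₁ t (y 0) ∧
      kappaMin (secondForm (P.family t) y) (metric (P.family t) y) = P.curv₂ t (y 0) := by
  have hl := P.len_pos hy
  obtain ⟨-, hR, -, -⟩ := id hy
  dsimp only at hR
  have hg : P.dR t (y 0) ^ 2 + P.dZ t (y 0) ^ 2 = P.len t (y 0) ^ 2 :=
    (Real.sq_sqrt (by positivity)).symm
  have e1 : P.turn t (y 0) / P.len t (y 0) / P.len t (y 0) ^ 2 = P.curv₁ t (y 0) := by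
    rw [curv₁]; field_simp
  have e2 : P.R t (y 0) * P.dZ t (y 0) / P.len t (y 0) / P.R t (y 0) ^ 2 = P.curv₂ t (y 0) := by
    rw [curv₂]; field_simp
  rw [secondForm_family P hy, metric_family P hy.1, hg]
  rw [kappaMax_diagonal _ _ _ _ (by positivity) (by positivity) (by rwa [e1, e2]),
    kappaMin_diagonal _ _ _ _ (by positivity) (by positivity) (by rwa [e1, e2]), e1, e2]
  exact ⟨rfl, rfl⟩

theorem curv₁_zero {u : ℝ} (hu : u ∈ P.domain) : P.curv₁ 0 u = P.k₁ u := by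
  have := hu.1.ne'
  rw [curv₁, turn_zero, len_zero P hu, k₁]
  field_simp

theorem curv₂_zero {u : ℝ} (hu : u ∈ P.domain) : P.curv₂ 0 u = P.k₂ u := by
  have := hu.1.ne'
  rw [curv₂, dZ_zero, len_zero P hu, R_zero, k₂]
  field_simp

theorem kappa_family_zero (hy : y 0 ∈ P.domain) (hle : P.k₂ (y 0) ≤ P.k₁ (y 0)) :
    kappaMax (secondForm (P.family 0) y) (metric (P.family 0) y) = P.k₁ (y 0) ∧
      kappaMin (secondForm (P.family 0) y) (metric (P.family 0) y) = P.k₂ (y 0) := by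
  rw [← curv₁_zero P hy, ← curv₂_zero P hy] at *
  exact P.kappa_family (P.mem_region hy) hle

theorem hasDerivAt_affine (a b t : ℝ) : HasDerivAt (fun t : ℝ => a - t * b) (-b) t := by
  have := ((hasDerivAt_id' t).mul_const b).const_sub a
  rwa [one_mul] at this

/-- The metric changes at the rate -2F h_{ij}; here h₁₁ = ρ, and `len` is the square root of g₁₁ =
ρ². -/
theorem hasDerivAt_len {u : ℝ} (hu : u ∈ P.domain) :
    HasDerivAt (fun t => P.len t u) (-P.speed u) 0 := by
  have h1 : HasDerivAt (fun t => P.dR t u) _ 0 := hasDerivAt_affine _ _ _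
  have h2 : HasDerivAt (fun t => P.dZ t u) _ 0 := hasDerivAt_affine _ _ _
  have h3 := ((h1.pow 2).add (h2.pow 2)).sqrt
    (by simpa [sq_len_zero] using hu.1.ne')
  have hs : √((-(P.rho u * Real.sin u)) ^ 2 + (P.rho u * Real.cos u) ^ 2) = P.rho u := by
    rw [← dR_zero, ← dZ_zero]; exact P.len_zero hu
  have hρ := hu.1.ne'
  refine h3.congr_deriv ?_
  simp only [Pi.add_apply, Pi.pow_apply, dR_zero, dZ_zero, hs]
  field_simp
  push_cast
  linear_combination (-2 * P.rho u * P.speed u) * Real.sin_sq_add_cos_sq u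

/-- This is dκ/dt = F_ss + F κ² for the profile, with the arclength derivative d/ds = ρ⁻¹ d/du and
ρ' = B. -/
theorem hasDerivAt_curv₁ {u : ℝ} (hu : u ∈ P.domain) :
    HasDerivAt (fun t => P.curv₁ t u)
      ((P.ddspeed u + P.speed u) / P.rho u ^ 2 - P.dspeed u * P.B / P.rho u ^ 3) 0 := by
  have h1 : HasDerivAt (fun t => P.dR t u) _ 0 := hasDerivAt_affine _ _ _
  have h2 : HasDerivAt (fun t => P.dZ t u) _ 0 := hasDerivAt_affine _ _ _
  have h3 : HasDerivAt (fun t => P.ddR t u) _ 0 := hasDerivAt_affine _ _ _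
  have h4 : HasDerivAt (fun t => P.ddZ t u) _ 0 := hasDerivAt_affine _ _ _
  have h5 := (h4.mul h1).sub (h3.mul h2)
  have h6 := (P.hasDerivAt_len hu).pow 3
  have hρ := hu.1.ne'
  have hl : P.len 0 u ^ 3 ≠ 0 := by rw [len_zero P hu]; exact pow_ne_zero 3 hρ
  refine (h5.div h6 hl).congr_deriv ?_
  simp only [Pi.sub_apply, Pi.mul_apply, Pi.pow_apply, len_zero P hu]
  simp only [dR_zero, dZ_zero, ddR, ddZ, zero_mul, sub_zero]
  field_simp
  push_cast
  have hc : Real.cos u ^ 2 = 1 - Real.sin u ^ 2 := Real.cos_sq' u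
  ring_nf
  simp only [hc]
  ring

/-- In the direction of rotation the Hessian of F in a unit frame is F_s r_s / r, where r is the
distance to the axis and r_s = -sin u. -/
theorem hasDerivAt_curv₂ {u : ℝ} (hu : u ∈ P.domain) :
    HasDerivAt (fun t => P.curv₂ t u)
      (P.speed u * P.k₂ u ^ 2 - P.dspeed u * (Real.sin u / P.rad u) / P.rho u) 0 := by
  have h1 : HasDerivAt (fun t => P.R t u) _ 0 := hasDerivAt_affine _ _ _
  have h2 : HasDerivAt (fun t => P.dZ t u) _ 0 := hasDerivAt_affine _ _ _
  have hρ := hu.1.ne'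
  have hr := hu.2.1.ne'
  have h3 := h1.mul (P.hasDerivAt_len hu)
  refine (h2.div h3 ?_).congr_deriv ?_
  · simp only [Pi.mul_apply, len_zero P hu, R_zero]; exact mul_ne_zero hr hρ
  · simp only [Pi.mul_apply, len_zero P hu, R_zero, dZ_zero, k₂]
    field_simp
    ring

/-- The function `w` along the profile curve at the time `0`, and its first two derivatives. -/
noncomputable def along (d : ℕ) (v : ℝ → ℝ) (u : ℝ) : ℝ := P.k₂ u ^ d * v (P.k₁ u / P.k₂ u)

noncomputable def quot₁ (u : ℝ) : ℝ := (P.dk₁ u * P.k₂ u - P.k₁ u * P.dk₂ u) / P.k₂ u ^ 2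

noncomputable def quot₂ (u : ℝ) : ℝ :=
  ((P.ddk₁ u * P.k₂ u - P.k₁ u * P.ddk₂ u) * P.k₂ u ^ 2 -
    (P.dk₁ u * P.k₂ u - P.k₁ u * P.dk₂ u) * (2 * P.k₂ u * P.dk₂ u)) / (P.k₂ u ^ 2) ^ 2

noncomputable def along₁ (d : ℕ) (v v₁ : ℝ → ℝ) (u : ℝ) : ℝ :=
  d * P.k₂ u ^ (d - 1) * P.dk₂ u * v (P.k₁ u / P.k₂ u) +
    P.k₂ u ^ d * (v₁ (P.k₁ u / P.k₂ u) * P.quot₁ u)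

/-! ### Derivatives of w along the profile and the value of L(w). -/

variable {P}

theorem hasDerivAt_quot {u : ℝ} (hu : u ∈ P.domain) :
    HasDerivAt (fun u => P.k₁ u / P.k₂ u) (P.quot₁ u) u :=
  (hasDerivAt_k₁ hu).div (hasDerivAt_k₂ hu) (k₂_pos hu).ne'

theorem hasDerivAt_quot₁ {u : ℝ} (hu : u ∈ P.domain) :
    HasDerivAt P.quot₁ (P.quot₂ u) u := by
  refine ((((hasDerivAt_dk₁ hu).mul (hasDerivAt_k₂ hu)).sub
    ((hasDerivAt_k₁ hu).mul (hasDerivAt_dk₂ hu))).div ((hasDerivAt_k₂ hu).pow 2)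
      (pow_ne_zero 2 (k₂_pos hu).ne')).congr_deriv ?_
  simp only [quot₂, Pi.sub_apply, Pi.mul_apply, Pi.pow_apply]
  congr 1
  push_cast
  ring

theorem hasDerivAt_along (H : IsHomogeneousRatio p q d v v₁ v₂) {u : ℝ} (hu : u ∈ P.domain) :
    HasDerivAt (P.along d v) (P.along₁ d v v₁ u) u :=
  hasDerivAt_pow_mul_comp (hasDerivAt_k₂ hu) (hasDerivAt_quot hu)
    (H.deriv₁ _ (div_pos (k₁_pos hu) (k₂_pos hu)))

theorem hasDerivAt_along₁ (H : IsHomogeneousRatio p q d v v₁ v₂) {u : ℝ} (hu : u ∈ P.domain)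
    (hk : P.k₂ u = 1) :
    HasDerivAt (P.along₁ d v v₁)
      (d * (d - 1) * P.dk₂ u ^ 2 * v (P.k₁ u) + d * P.ddk₂ u * v (P.k₁ u) +
        2 * d * P.dk₂ u * v₁ (P.k₁ u) * P.quot₁ u + v₂ (P.k₁ u) * P.quot₁ u ^ 2 +
          v₁ (P.k₁ u) * P.quot₂ u) u := by
  have hx := div_pos (k₁_pos hu) (k₂_pos hu)
  have hq := hasDerivAt_quot hu
  have h2 := hasDerivAt_k₂ hu
  have A := ((((h2.pow (d - 1)).const_mul (d : ℝ)).mul (hasDerivAt_dk₂ hu)).mul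
    ((H.deriv₁ _ hx).comp u hq))
  have B := (h2.pow d).mul (((H.deriv₂ _ hx).comp u hq).mul (hasDerivAt_quot₁ hu))
  refine (A.add B).congr_deriv ?_
  -- The exponent d - 1 - 1 is a truncated subtraction, harmless because the base `k₂` equals 1. The
  -- factor d - 1 is cast to the reals by means of d ≥ 1.
  simp only [Pi.mul_apply, Pi.pow_apply, Function.comp_apply, hk, one_pow, div_one,
    Nat.cast_sub H.one_le, Nat.cast_one, mul_one, one_mul]
  ring

/-- The strict inequality persists nearby, so there `kappaMax` and `kappaMin` agree with the smooth
functions `k₁` and `k₂` and can be differentiated. -/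
theorem eventually_k₂_lt {u : ℝ} (hu : u ∈ P.domain) (hlt : P.k₂ u < P.k₁ u) :
    ∀ᶠ s in nhds u, s ∈ P.domain ∧ P.k₂ s < P.k₁ s :=
  (P.isOpen_domain.eventually_mem hu).and
    ((hasDerivAt_k₂ hu).continuousAt.eventually_lt (hasDerivAt_k₁ hu).continuousAt hlt)

theorem surfaceW_family_zero (H : IsHomogeneousRatio p q d v v₁ v₂) (hy : y 0 ∈ P.domain)
    (hle : P.k₂ (y 0) ≤ P.k₁ (y 0)) :
    surfaceW p q (P.family 0) y = P.along d v (y 0) := by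
  obtain ⟨h1, h2⟩ := P.kappa_family_zero hy hle
  rw [surfaceW, h1, h2, H.ratio_eq _ _ (k₁_pos hy) (k₂_pos hy), along]

theorem eventually_surfaceW_family_zero (H : IsHomogeneousRatio p q d v v₁ v₂)
    (hy : y 0 ∈ P.domain) (hlt : P.k₂ (y 0) < P.k₁ (y 0)) :
    surfaceW p q (P.family 0) =ᶠ[nhds y] fun z => P.along d v (z 0) :=
  ((continuous_apply 0).continuousAt.eventually (eventually_k₂_lt hy hlt)).mono fun _ hz =>
    surfaceW_family_zero H hz.1 hz.2.le

theorem pd_zero_surfaceW (H : IsHomogeneousRatio p q d v v₁ v₂) (hy : y 0 ∈ P.domain)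
    (hlt : P.k₂ (y 0) < P.k₁ (y 0)) :
    pd 0 (surfaceW p q (P.family 0)) y = P.along₁ d v v₁ (y 0) := by
  rw [pd_congr 0 (eventually_surfaceW_family_zero H hy hlt)]
  exact pd_zero_coord (hasDerivAt_along H hy)

theorem pd_one_surfaceW (H : IsHomogeneousRatio p q d v v₁ v₂) (hy : y 0 ∈ P.domain)
    (hlt : P.k₂ (y 0) < P.k₁ (y 0)) :
    pd 1 (surfaceW p q (P.family 0)) y = 0 := by
  rw [pd_congr 1 (eventually_surfaceW_family_zero H hy hlt)]
  exact pd_one_coord (hasDerivAt_along H hy)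

theorem isCriticalPoint (H : IsHomogeneousRatio p q d v v₁ v₂) (hy : y 0 ∈ P.domain)
    (hlt : P.k₂ (y 0) < P.k₁ (y 0)) (hc : P.along₁ d v v₁ (y 0) = 0) :
    IsCriticalPoint p q (P.family 0) y := by
  intro i
  fin_cases i
  · exact (pd_zero_surfaceW H hy hlt).trans hc
  · exact pd_one_surfaceW H hy hlt

theorem covHess_of_isCriticalPoint {X : Param → Space} (hc : IsCriticalPoint p q X y)
    (i j : Fin 2) :
    covHess X (surfaceW p q X) i j y = pd j (pd i (surfaceW p q X)) y := by
  simp [covHess, hc 0, hc 1]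

theorem deriv_surfaceW_family (H : IsHomogeneousRatio p q d v v₁ v₂) (hy : y 0 ∈ P.domain)
    (hlt : P.k₂ (y 0) < P.k₁ (y 0)) (hk : P.k₂ (y 0) = 1) {c₁ c₂ : ℝ}
    (h₁ : HasDerivAt (fun t => P.curv₁ t (y 0)) c₁ 0)
    (h₂ : HasDerivAt (fun t => P.curv₂ t (y 0)) c₂ 0) :
    deriv (fun t => surfaceW p q (P.family t) y) 0 =
      d * c₂ * v (P.k₁ (y 0)) + v₁ (P.k₁ (y 0)) * (c₁ - P.k₁ (y 0) * c₂) := by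
  have e1 := P.curv₁_zero hy
  have e2 := P.curv₂_zero hy
  have hreg : ∀ᶠ t : ℝ in nhds 0, (t, y) ∈ P.region :=
    (Continuous.prodMk_left y).continuousAt.eventually_mem
      (P.isOpen_region.mem_nhds (P.mem_region hy))
  have hlt' : ∀ᶠ t : ℝ in nhds 0, P.curv₂ t (y 0) < P.curv₁ t (y 0) :=
    h₂.continuousAt.eventually_lt h₁.continuousAt (by rwa [e1, e2])
  have hev : (fun t => surfaceW p q (P.family t) y) =ᶠ[nhds 0]
      fun t => P.curv₂ t (y 0) ^ d * v (P.curv₁ t (y 0) / P.curv₂ t (y 0)) := by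
    filter_upwards [hreg, hlt'] with t ht hl
    have hp := P.len_pos ht
    obtain ⟨ha, hb⟩ := P.kappa_family ht hl.le
    have p2 : 0 < P.curv₂ t (y 0) := div_pos ht.2.2.1 (mul_pos ht.2.1 hp)
    rw [surfaceW, ha, hb, H.ratio_eq _ _ (p2.trans hl) p2]
  have hx : 0 < P.curv₁ 0 (y 0) / P.curv₂ 0 (y 0) := by
    rw [e1, e2]; exact div_pos (k₁_pos hy) (k₂_pos hy)
  have hd := hasDerivAt_pow_mul_comp (d := d) h₂ (h₁.div h₂ (by rw [e2, hk]; exact one_ne_zero))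
    (H.deriv₁ _ hx)
  rw [hev.deriv_eq]
  refine hd.deriv.trans ?_
  simp only [Pi.div_apply, e1, e2, hk, one_pow, div_one, mul_one, one_mul]

/-- At a critical point the Christoffel terms of the Hessian drop out. Since w does not depend on
the angle of rotation and F^{ij} is diagonal, only F^{11} times the second derivative along the
profile remains. -/
theorem evolutionOp_family (H : IsHomogeneousRatio p q d v v₁ v₂) (hy : y 0 ∈ P.domain)
    (hlt : P.k₂ (y 0) < P.k₁ (y 0)) (hk : P.k₂ (y 0) = 1) (hc : P.along₁ d v v₁ (y 0) = 0)
    {c₁ c₂ c₃ : ℝ}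
    (h₁ : HasDerivAt (fun t => P.curv₁ t (y 0)) c₁ 0)
    (h₂ : HasDerivAt (fun t => P.curv₂ t (y 0)) c₂ 0)
    (h₃ : HasDerivAt (P.along₁ d v v₁) c₃ (y 0)) :
    evolutionOp (gaussPower P.σ) p q P.family 0 y =
      d * c₂ * v (P.k₁ (y 0)) + v₁ (P.k₁ (y 0)) * (c₁ - P.k₁ (y 0) * c₂) -
        P.σ * P.speed (y 0) * P.k₁ (y 0) * c₃ := by
  have hcrit := isCriticalPoint H hy hlt hc
  have hev : ∀ᶠ z in nhds y, z 0 ∈ P.domain ∧ P.k₂ (z 0) < P.k₁ (z 0) :=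
    (continuous_apply 0).continuousAt.eventually (eventually_k₂_lt hy hlt)
  have h00 : pd 0 (pd 0 (surfaceW p q (P.family 0))) y = c₃ := by
    rw [pd_congr 0 (hev.mono fun z hz => pd_zero_surfaceW H hz.1 hz.2)]
    exact pd_zero_coord h₃
  have h11 : pd 1 (pd 1 (surfaceW p q (P.family 0))) y = 0 := by
    rw [pd_congr 1 (hev.mono fun z hz => pd_one_surfaceW H hz.1 hz.2)]
    simp [pd]
  have hρ := hy.1
  have hr := hy.2.1
  have hcos := hy.2.2
  have hV : velocityDeriv (gaussPower P.σ) (secondForm (P.family 0) y) (metric (P.family 0) y)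
      0 0 = P.σ * P.speed (y 0) * P.k₁ (y 0) := by
    have := P.gaussPower_family_zero hy
    rw [secondForm_family_zero P hy, metric_family_zero P hy, gaussPower,
      gaussCurv_diagonal] at this
    rw [secondForm_family_zero P hy, metric_family_zero P hy,
      velocityDeriv_gaussPower_diagonal hρ (mul_pos hr hcos) (pow_pos hρ 2) (pow_pos hr 2),
      this, k₁]
    ring
  have hV' : ∀ i j : Fin 2, i ≠ j → velocityDeriv (gaussPower P.σ)
      (secondForm (P.family 0) y) (metric (P.family 0) y) i j = 0 := fun i j hij => by
    rw [secondForm_family_zero P hy, metric_family_zero P hy,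
      velocityDeriv_gaussPower_diagonal_of_ne hij]
  rw [evolutionOp, deriv_surfaceW_family H hy hlt hk h₁ h₂]
  simp only [Fin.sum_univ_two, covHess_of_isCriticalPoint hcrit, h00, h11, hV,
    hV' 0 1 (by decide), hV' 1 0 (by decide)]
  ring

/-- On a surface of revolution whose profile curve is a circular arc, the covariant derivatives
of the second fundamental form vanish on the equator. -/
theorem covSecondFormVanishes (hB : P.B = 0) (hy : y 0 ∈ P.domain) (hs : Real.sin (y 0) = 0) :
    CovSecondFormVanishes (P.family 0) y := by
  have hev := eventually_coord_mem P.isOpen_domain hy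
  -- On the equator `rad`, `rho` and the cosine are all stationary. Hence so are the coefficients of
  -- both fundamental forms, and the Christoffel symbols vanish.
  have hr : HasDerivAt P.rad 0 (y 0) := by simpa [hs] using P.hasDerivAt_rad (y 0)
  have hρ : HasDerivAt P.rho 0 (y 0) := by simpa [hB] using P.hasDerivAt_rho (y 0)
  have hcos : HasDerivAt Real.cos 0 (y 0) := by simpa [hs] using Real.hasDerivAt_cos (y 0)
  have hpd : ∀ (f : ℝ → ℝ) (k : Fin 2), HasDerivAt f 0 (y 0) →
      pd k (fun z : Param => f (z 0)) y = 0 := fun f k hf => by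
    fin_cases k
    exacts [pd_zero_coord hf, pd_one_coord hf]
  have hg : ∀ i j k, pd k (fun z => metric (P.family 0) z i j) y = 0 := fun i j k => by
    have e : (fun z => metric (P.family 0) z i j) =ᶠ[nhds y] fun z =>
        (fun u => Matrix.diagonal ![P.rho u ^ 2, P.rad u ^ 2] i j) (z 0) :=
      hev.mono fun z hz => by simp only [metric_family_zero P hz]
    rw [pd_congr k e]
    refine hpd (fun u => Matrix.diagonal ![P.rho u ^ 2, P.rad u ^ 2] i j) k ?_
    have h1 := hρ.pow 2
    have h2 := hr.pow 2
    rw [mul_zero] at h1 h2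
    fin_cases i <;> fin_cases j
    exacts [h1, hasDerivAt_const _ 0, hasDerivAt_const _ 0, h2]
  have hh : ∀ i j k, pd k (fun z => secondForm (P.family 0) z i j) y = 0 := fun i j k => by
    have e : (fun z => secondForm (P.family 0) z i j) =ᶠ[nhds y] fun z =>
        (fun u => Matrix.diagonal ![P.rho u, P.rad u * Real.cos u] i j) (z 0) :=
      hev.mono fun z hz => by simp only [secondForm_family_zero P hz]
    rw [pd_congr k e]
    refine hpd (fun u => Matrix.diagonal ![P.rho u, P.rad u * Real.cos u] i j) k ?_
    have h2 := hr.mul hcos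
    rw [zero_mul, mul_zero, add_zero] at h2
    fin_cases i <;> fin_cases j
    exacts [hρ, hasDerivAt_const _ 0, hasDerivAt_const _ 0, h2]
  have hΓ : ∀ k i j, christoffel (P.family 0) k i j y = 0 := fun k i j => by
    simp [christoffel, hg]
  intro i j k
  simp [covSecondForm, hh, hΓ]

end Cap

/-! ### Homogeneous polynomials in two variables -/

theorem eval_of_isHomogeneous {p : MvPolynomial (Fin 2) ℝ} {n : ℕ} (hp : p.IsHomogeneous n)
    (c a b : ℝ) :
    MvPolynomial.eval ![c * a, c * b] p = c ^ n * MvPolynomial.eval ![a, b] p := by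
  rw [MvPolynomial.eval_eq', MvPolynomial.eval_eq', Finset.mul_sum]
  refine Finset.sum_congr rfl fun m hm => ?_
  have h : m.degree = n := by
    rw [Finsupp.degree_eq_weight_one]
    exact hp (MvPolynomial.mem_support_iff.1 hm)
  rw [Finsupp.degree_eq_sum, Fin.sum_univ_two] at h
  simp only [Fin.prod_univ_two, Matrix.cons_val_zero, Matrix.cons_val_one, mul_pow, ← h, pow_add]
  ring

/-- The dehomogenization `p(X, 1)`. -/
noncomputable def dehomogenize (p : MvPolynomial (Fin 2) ℝ) : Polynomial ℝ :=
  MvPolynomial.aeval ![Polynomial.X, 1] p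

theorem eval_dehomogenize (p : MvPolynomial (Fin 2) ℝ) (x : ℝ) :
    (dehomogenize p).eval x = MvPolynomial.eval ![x, 1] p := by
  rw [dehomogenize, MvPolynomial.aeval_def, ← Polynomial.coe_evalRingHom,
    MvPolynomial.eval₂_comp_left, MvPolynomial.eval, MvPolynomial.coe_eval₂Hom]
  congr 1
  · ext; simp
  · ext i; fin_cases i <;> simp

/-! ### Logarithmic derivatives of rational functions at infinity. -/

section Asymptotics

open Filter Topology Polynomial

theorem tendsto_eval_div_atTop {N P : ℝ[X]} (hP : P ≠ 0) (hN : N.natDegree ≤ P.natDegree) :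
    Tendsto (fun x => N.eval x / P.eval x) atTop (𝓝 (N.coeff P.natDegree / P.leadingCoeff)) := by
  rcases hN.lt_or_eq with h | h
  · rw [coeff_eq_zero_of_natDegree_lt h, zero_div]
    exact div_tendsto_atTop_zero_of_degree_lt N P (degree_lt_degree h)
  · rcases eq_or_ne N 0 with rfl | hN0
    · simp
    · rw [← h, coeff_natDegree]
      exact div_tendsto_atTop_leadingCoeff_div_of_degree_eq N P
        (by rw [degree_eq_natDegree hN0, degree_eq_natDegree hP, h])

/-- The polynomial X P' has degree at most deg P, and its coefficient in that degree is deg P times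
the leading coefficient of P. -/
theorem tendsto_mul_eval_derivative_div {P : ℝ[X]} (hP : P ≠ 0) :
    Tendsto (fun x => x * (derivative P).eval x / P.eval x) atTop (𝓝 P.natDegree) := by
  have hlc : P.leadingCoeff ≠ 0 := leadingCoeff_ne_zero.2 hP
  have hdeg : (X * derivative P).natDegree ≤ P.natDegree := by
    refine natDegree_le_iff_coeff_eq_zero.2 fun n hn => ?_
    obtain ⟨k, rfl⟩ : ∃ k, n = k + 1 := ⟨n - 1, by omega⟩
    rw [coeff_X_mul, coeff_derivative, coeff_eq_zero_of_natDegree_lt hn, zero_mul]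
  have h := tendsto_eval_div_atTop hP hdeg
  have hc : (X * derivative P).coeff P.natDegree = P.natDegree * P.leadingCoeff := by
    rcases hn : P.natDegree with _ | k
    · simp
    · rw [coeff_X_mul, coeff_derivative, ← hn, coeff_natDegree, hn]
      push_cast
      ring
  rw [hc, mul_div_cancel_right₀ _ hlc] at h
  simpa using h

theorem tendsto_sq_mul_eval_derivative_div {P : ℝ[X]} (hP : P ≠ 0) :
    Tendsto (fun x => x ^ 2 * (derivative (derivative P)).eval x / P.eval x) atTop
      (𝓝 (P.natDegree * (P.natDegree - 1))) := by
  have hlc : P.leadingCoeff ≠ 0 := leadingCoeff_ne_zero.2 hP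
  have hdeg : (X ^ 2 * derivative (derivative P)).natDegree ≤ P.natDegree := by
    refine natDegree_le_iff_coeff_eq_zero.2 fun n hn => ?_
    rcases lt_or_ge n 2 with h2 | h2
    · exact coeff_X_pow_mul' _ _ _ |>.trans (if_neg (by omega))
    · obtain ⟨k, rfl⟩ : ∃ k, n = k + 2 := ⟨n - 2, by omega⟩
      rw [coeff_X_pow_mul, coeff_derivative, coeff_derivative,
        coeff_eq_zero_of_natDegree_lt hn, zero_mul, zero_mul]
  have h := tendsto_eval_div_atTop hP hdeg
  have hc : (X ^ 2 * derivative (derivative P)).coeff P.natDegree =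
      P.natDegree * (P.natDegree - 1) * P.leadingCoeff := by
    rcases hn : P.natDegree with _ | _ | k
    · simp
    · simp [coeff_X_pow_mul']
    · rw [coeff_X_pow_mul, coeff_derivative, coeff_derivative, show k + 1 + 1 = P.natDegree from
        hn.symm, coeff_natDegree, hn]
      push_cast
      ring
  rw [hc, mul_div_cancel_right₀ _ hlc] at h
  simpa using h

/-- The derivative of the quotient `P / Q`. -/
noncomputable def quotDeriv (P Q : ℝ[X]) (x : ℝ) : ℝ :=
  ((derivative P).eval x * Q.eval x - P.eval x * (derivative Q).eval x) / Q.eval x ^ 2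

/-- The second derivative of the quotient `P / Q`. -/
noncomputable def quotDeriv₂ (P Q : ℝ[X]) (x : ℝ) : ℝ :=
  (((derivative (derivative P)).eval x * Q.eval x -
      P.eval x * (derivative (derivative Q)).eval x) * Q.eval x ^ 2 -
    ((derivative P).eval x * Q.eval x - P.eval x * (derivative Q).eval x) *
      (2 * Q.eval x * (derivative Q).eval x)) / (Q.eval x ^ 2) ^ 2

theorem hasDerivAt_quotDeriv (P Q : ℝ[X]) {x : ℝ} (h : Q.eval x ≠ 0) :
    HasDerivAt (fun x => P.eval x / Q.eval x) (quotDeriv P Q x) x :=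
  (P.hasDerivAt x).div (Q.hasDerivAt x) h

theorem hasDerivAt_quotDeriv₂ (P Q : ℝ[X]) {x : ℝ} (h : Q.eval x ≠ 0) :
    HasDerivAt (quotDeriv P Q) (quotDeriv₂ P Q x) x := by
  refine (((((derivative P).hasDerivAt x).mul (Q.hasDerivAt x)).sub ((P.hasDerivAt x).mul
    ((derivative Q).hasDerivAt x))).div ((Q.hasDerivAt x).pow 2) (pow_ne_zero 2 h)).congr_deriv ?_
  simp only [quotDeriv₂, Pi.sub_apply, Pi.mul_apply, Pi.pow_apply]
  congr 1
  push_cast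
  ring

theorem eventually_eval_ne_zero {P : ℝ[X]} (hP : P ≠ 0) : ∀ᶠ x in atTop, P.eval x ≠ 0 :=
  eventually_atTop_not_isRoot P hP

theorem tendsto_logDeriv_quot {P Q : ℝ[X]} (hP : P ≠ 0) (hQ : Q ≠ 0) :
    Tendsto (fun x => x * quotDeriv P Q x / (P.eval x / Q.eval x)) atTop
      (𝓝 ((P.natDegree : ℝ) - Q.natDegree)) := by
  refine ((tendsto_mul_eval_derivative_div hP).sub (tendsto_mul_eval_derivative_div hQ)).congr' ?_
  filter_upwards [eventually_eval_ne_zero hP, eventually_eval_ne_zero hQ] with x h1 h2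
  rw [quotDeriv]
  field_simp

/-- The limit is the one for the pure power x^m with m = deg P - deg Q. It is assembled from the
limits for P and Q by expanding (P/Q)''. -/
theorem tendsto_logDeriv₂_quot {P Q : ℝ[X]} (hP : P ≠ 0) (hQ : Q ≠ 0) :
    Tendsto (fun x => x ^ 2 * quotDeriv₂ P Q x / (P.eval x / Q.eval x)) atTop
      (𝓝 (((P.natDegree : ℝ) - Q.natDegree) * (P.natDegree - Q.natDegree - 1))) := by
  have p1 := tendsto_mul_eval_derivative_div hP
  have q1 := tendsto_mul_eval_derivative_div hQ
  have p2 := tendsto_sq_mul_eval_derivative_div hP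
  have q2 := tendsto_sq_mul_eval_derivative_div hQ
  have h := ((p2.sub ((p1.mul q1).const_mul 2)).sub q2).add ((q1.mul q1).const_mul 2)
  have e : ((P.natDegree : ℝ) - Q.natDegree) * (P.natDegree - Q.natDegree - 1) =
      (P.natDegree : ℝ) * (P.natDegree - 1) - 2 * (P.natDegree * Q.natDegree) -
        Q.natDegree * (Q.natDegree - 1) + 2 * (Q.natDegree * Q.natDegree) := by ring
  rw [e]
  refine h.congr' ?_
  filter_upwards [eventually_eval_ne_zero hP, eventually_eval_ne_zero hQ] with x h1 h2
  rw [quotDeriv₂]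
  field_simp
  ring

end Asymptotics

/-! ### Growth of w(x, 1) forced by symmetry, homogeneity and monotonicity. -/

namespace IsMaximumPrincipleFunction

variable {F : Mat2 → Mat2 → ℝ} {p q : MvPolynomial (Fin 2) ℝ}

theorem eval_dehomogenize_pos (h : IsMaximumPrincipleFunction F p q) {x : ℝ} (hx : 0 < x) :
    0 < (dehomogenize q).eval x := by
  rw [eval_dehomogenize]; exact h.q_pos x 1 hx one_pos

theorem ratio_one (p q : MvPolynomial (Fin 2) ℝ) (x : ℝ) :
    ratio p q x 1 = (dehomogenize p).eval x / (dehomogenize q).eval x := by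
  rw [ratio, eval_dehomogenize, eval_dehomogenize]

theorem ratio_eq_pow_mul (h : IsMaximumPrincipleFunction F p q) {a b : ℝ} (hb : 0 < b) :
    ratio p q a b = b ^ (p.totalDegree - q.totalDegree) * ratio p q (a / b) 1 := by
  have hab : (![a, b] : Fin 2 → ℝ) = ![b * (a / b), b * 1] := by
    rw [mul_div_cancel₀ _ hb.ne', mul_one]
  rw [ratio, ratio, hab, eval_of_isHomogeneous h.p_homogeneous,
    eval_of_isHomogeneous h.q_homogeneous, mul_div_mul_comm]
  congr 1
  rw [div_eq_iff (pow_pos hb _).ne', ← pow_add, Nat.sub_add_cancel h.degree_lt.le]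

theorem isHomogeneousRatio (h : IsMaximumPrincipleFunction F p q) :
    IsHomogeneousRatio p q (p.totalDegree - q.totalDegree)
      (fun x => (dehomogenize p).eval x / (dehomogenize q).eval x)
      (quotDeriv (dehomogenize p) (dehomogenize q))
      (quotDeriv₂ (dehomogenize p) (dehomogenize q)) where
  one_le := Nat.sub_pos_of_lt h.degree_lt
  ratio_eq a b _ hb := by rw [h.ratio_eq_pow_mul hb, ratio_one]
  deriv₁ x hx := hasDerivAt_quotDeriv _ _ (h.eval_dehomogenize_pos hx).ne'
  deriv₂ x hx := hasDerivAt_quotDeriv₂ _ _ (h.eval_dehomogenize_pos hx).ne'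

theorem ratio_comm (h : IsMaximumPrincipleFunction F p q) {a b : ℝ} (ha : 0 < a) (hb : 0 < b) :
    ratio p q a b = ratio p q b a := by
  have hs : (![a, b] : Fin 2 → ℝ) ∘ (Equiv.swap 0 1) = ![b, a] := by
    ext i; fin_cases i <;> simp
  have e := congrArg (MvPolynomial.eval ![a, b]) h.symmetric
  rw [map_mul, map_mul, MvPolynomial.eval_rename, MvPolynomial.eval_rename, hs] at e
  rw [ratio, ratio, div_eq_div_iff (h.q_pos a b ha hb).ne' (h.q_pos b a hb ha).ne', e]

theorem quotDeriv_pos (h : IsMaximumPrincipleFunction F p q) {x : ℝ} (hx : 1 < x) :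
    0 < quotDeriv (dehomogenize p) (dehomogenize q) x := by
  have := h.increasing x hx
  rw [funext (ratio_one p q)] at this
  rwa [(h.isHomogeneousRatio.deriv₁ x (by linarith)).deriv] at this

theorem dehomogenize_ne_zero (h : IsMaximumPrincipleFunction F p q) : dehomogenize p ≠ 0 := by
  intro h0
  have := h.quotDeriv_pos (x := 2) (by norm_num)
  simp [quotDeriv, h0] at this

theorem dehomogenize_ne_zero' (h : IsMaximumPrincipleFunction F p q) : dehomogenize q ≠ 0 := by
  intro h0
  have := h.eval_dehomogenize_pos (x := 1) one_pos
  simp [h0] at this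

/-- By (III) w(·, 1) decreases strictly on (0, 1] to its value 0 at the umbilic ratio 1. The point
1/2 is an arbitrary reference point in (0, 1). -/
theorem ratio_half_pos (h : IsMaximumPrincipleFunction F p q) : 0 < ratio p q (1 / 2) 1 := by
  have hd : StrictAntiOn (fun r => ratio p q r 1) (Set.Ioc 0 1) := by
    refine strictAntiOn_of_deriv_neg (convex_Ioc 0 1) (fun x hx => ?_) fun x hx => ?_
    · rw [funext (ratio_one p q)]
      exact (h.isHomogeneousRatio.deriv₁ x hx.1).continuousAt.continuousWithinAt
    · rw [interior_Ioc] at hx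
      exact h.decreasing x hx.1 hx.2
  have h1 := hd (a := 1 / 2) (b := 1) ⟨by norm_num, by norm_num⟩ ⟨one_pos, le_rfl⟩ (by norm_num)
  have h2 : ratio p q 1 1 = 0 := by rw [ratio, h.p_umbilic 1 one_pos, zero_div]
  simpa only [h2] using h1

/-- Symmetry and homogeneity give w(x, 1) = w(1, x) = x^d w(1/x, 1), and w(·, 1) is decreasing on
(0, 1) with 1/x < 1/2. -/
theorem ratio_half_le (h : IsMaximumPrincipleFunction F p q) {x : ℝ} (hx : 2 < x) :
    x ^ (p.totalDegree - q.totalDegree) * ratio p q (1 / 2) 1 ≤ ratio p q x 1 := by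
  have hx0 : 0 < x := by linarith
  have hd : AntitoneOn (fun r => ratio p q r 1) (Set.Ioo 0 1) := by
    refine (strictAntiOn_of_deriv_neg (convex_Ioo 0 1) (fun x hx => ?_) fun x hx => ?_).antitoneOn
    · rw [funext (ratio_one p q)]
      exact (h.isHomogeneousRatio.deriv₁ x hx.1).continuousAt.continuousWithinAt
    · rw [interior_Ioo] at hx
      exact h.decreasing x hx.1 hx.2
  rw [h.ratio_comm hx0 one_pos, h.ratio_eq_pow_mul hx0]
  have hlt : 1 / x < 1 / 2 := one_div_lt_one_div_of_lt two_pos hx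
  exact mul_le_mul_of_nonneg_left
    (hd ⟨by positivity, by linarith⟩ ⟨by norm_num, by norm_num⟩ hlt.le) (by positivity)

/-- If the degree were smaller, w(x, 1)/x^d would tend to 0, although it is at least the positive
number w(1/2, 1) for x > 2. -/
theorem degree_le (h : IsMaximumPrincipleFunction F p q) :
    (dehomogenize q).natDegree + (p.totalDegree - q.totalDegree) ≤
      (dehomogenize p).natDegree := by
  by_contra! hlt
  set d := p.totalDegree - q.totalDegree
  have hdeg : (dehomogenize p).degree < (dehomogenize q * Polynomial.X ^ d).degree := by
    refine Polynomial.degree_lt_degree ?_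
    rwa [Polynomial.natDegree_mul_X_pow d h.dehomogenize_ne_zero']
  have ht := Polynomial.div_tendsto_atTop_zero_of_degree_lt _ _ hdeg
  refine absurd (ge_of_tendsto ht (b := ratio p q (1 / 2) 1) ?_) (not_le.2 h.ratio_half_pos)
  filter_upwards [Filter.eventually_gt_atTop 2] with x hx
  have hx0 : 0 < x := by linarith
  have hl := h.ratio_half_le hx
  rw [ratio_one p q x] at hl
  rw [Polynomial.eval_mul, Polynomial.eval_pow, Polynomial.eval_X, ← div_div,
    le_div_iff₀ (pow_pos hx0 d), mul_comm]
  exact hl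

end IsMaximumPrincipleFunction

/-! ### Comparison of two surfaces with the same principal curvatures -/

namespace Cap

/-- The cap with principal curvatures `x` and `1` at the normal angle `φ`, where the radius of
curvature of the profile has derivative `B`. -/
noncomputable def normalized (σ x φ B : ℝ) : Cap where
  A := 1 / x
  B := B
  C := Real.cos φ - 1 / x * Real.cos φ + B * Real.sin φ
  φ := φ
  σ := σ

variable {σ x φ B : ℝ}

theorem rho_normalized : (normalized σ x φ B).rho φ = 1 / x := by simp [rho, normalized]

/-- The constant C of `normalized` is chosen to achieve this, which makes the second curvature cos φ
/ `rad` equal to 1. -/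
theorem rad_normalized : (normalized σ x φ B).rad φ = Real.cos φ := by
  rw [rad, rho_normalized, normalized]; ring

theorem mem_domain_normalized (hx : 0 < x) (hφ : 0 < Real.cos φ) :
    φ ∈ (normalized σ x φ B).domain := by
  refine ⟨?_, ?_, hφ⟩
  · rw [rho_normalized]; positivity
  · rwa [rad_normalized]

theorem k₁_normalized : (normalized σ x φ B).k₁ φ = x := by
  rw [k₁, rho_normalized, one_div_one_div]

theorem k₂_normalized (hφ : 0 < Real.cos φ) : (normalized σ x φ B).k₂ φ = 1 := by
  rw [k₂, rad_normalized, div_self hφ.ne']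

theorem dk₁_normalized : (normalized σ x φ B).dk₁ φ = -B * x ^ 2 := by
  rw [dk₁, rho_normalized, normalized]; simp

theorem ddk₁_normalized : (normalized σ x φ B).ddk₁ φ = 2 * B ^ 2 * x ^ 3 := by
  rw [ddk₁, rho_normalized, normalized]; simp

theorem dk₂_normalized (hφ : 0 < Real.cos φ) :
    (normalized σ x φ B).dk₂ φ = Real.tan φ * (1 / x - 1) := by
  rw [dk₂, rho_normalized, k₂_normalized hφ, rad_normalized, mul_one, Real.tan_eq_sin_div_cos]

theorem ddk₂_normalized (hφ : 0 < Real.cos φ) :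
    (normalized σ x φ B).ddk₂ φ = (1 + 1 / x * Real.tan φ ^ 2) * (1 / x - 1) +
      Real.tan φ * (B + 1 / x * (Real.tan φ * (1 / x - 1))) := by
  rw [ddk₂, dk₂_normalized hφ, rho_normalized, k₂_normalized hφ, rad_normalized,
    ← Real.tan_eq_sin_div_cos]
  simp [normalized]

theorem speed_normalized (hφ : 0 < Real.cos φ) : (normalized σ x φ B).speed φ = x ^ σ := by
  rw [speed, k₁_normalized, k₂_normalized hφ, mul_one]; rfl

theorem along₁_normalized {d : ℕ} {v v₁ : ℝ → ℝ} (hφ : 0 < Real.cos φ) :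
    (normalized σ x φ B).along₁ d v v₁ φ =
      d * (Real.tan φ * (1 / x - 1)) * v x +
        v₁ x * (-B * x ^ 2 - x * (Real.tan φ * (1 / x - 1))) := by
  simp [along₁, quot₁, k₁_normalized, k₂_normalized hφ, dk₁_normalized, dk₂_normalized hφ]

/-- Here a and b are the first derivatives of the two curvatures in u, b' is the second derivative
of `k₂`, s is the logarithmic derivative of the speed, and `hc` says that w is critical. The formula
serves both surfaces of the comparison. -/
theorem evolutionOp_normalized {p q : MvPolynomial (Fin 2) ℝ} {d : ℕ} {v v₁ v₂ : ℝ → ℝ}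
    (H : IsHomogeneousRatio p q d v v₁ v₂) (hx : 1 < x) (hφ : 0 < Real.cos φ)
    {a b b' s : ℝ} (ha : a = -B * x ^ 2) (hb : b = Real.tan φ * (1 / x - 1))
    (hb' : b' = (1 + 1 / x * Real.tan φ ^ 2) * (1 / x - 1) + Real.tan φ * (B + 1 / x * b))
    (hs : s = σ * (a / x + b))
    (hc : d * b * v x + v₁ x * (a - x * b) = 0) :
    evolutionOp (gaussPower σ) p q (normalized σ x φ B).family 0 ![φ, 0] =
      x ^ σ * (d * (1 - s * Real.tan φ * x) * v x +
        v₁ x * (x ^ 2 * (s ^ 2 + σ * (a ^ 2 / x ^ 2 + b' - b ^ 2) + 1) - s * B * x ^ 3 -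
          x * (1 - s * Real.tan φ * x)) -
        σ * x * (d * (d - 1) * b ^ 2 * v x + d * b' * v x + 2 * d * b * v₁ x * (a - x * b) +
          v₂ x * (a - x * b) ^ 2 +
          v₁ x * (2 * a ^ 2 / x - x * b' - 2 * (a - x * b) * b))) := by
  have hx0 : 0 < x := by linarith
  have hφ' := hφ.ne'
  set P := normalized σ x φ B with hP
  have hy : (![φ, 0] : Param) 0 ∈ P.domain := mem_domain_normalized hx0 hφ
  have e1 : P.k₁ φ = x := k₁_normalized
  have e2 : P.k₂ φ = 1 := k₂_normalized hφ
  have e3 : P.dk₁ φ = a := dk₁_normalized.trans ha.symm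
  have e4 : P.dk₂ φ = b := (dk₂_normalized hφ).trans hb.symm
  have e5 : P.ddk₁ φ = 2 * a ^ 2 / x := ddk₁_normalized.trans (by rw [ha]; field_simp)
  have e6 : P.ddk₂ φ = b' := (ddk₂_normalized hφ).trans (by rw [hb', hb])
  have e7 : P.speed φ = x ^ σ := speed_normalized hφ
  have e8 : P.dspeed φ = x ^ σ * s := by
    rw [dspeed, e7, e1, e2, e3, e4, hs, div_one]; rfl
  have e9 : P.ddspeed φ = x ^ σ * (s ^ 2 + σ * (a ^ 2 / x ^ 2 + b' - b ^ 2)) := by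
    rw [ddspeed, e8, e7, e1, e2, e3, e4, e5, e6, hs, show P.σ = σ from rfl]
    field_simp
    ring
  have e10 : P.rho φ = 1 / x := rho_normalized
  have e11 : Real.sin φ / P.rad φ = Real.tan φ := by
    rw [hP, rad_normalized, Real.tan_eq_sin_div_cos]
  have hcrit : P.along₁ d v v₁ ((![φ, 0] : Param) 0) = 0 := by
    refine (along₁_normalized hφ).trans ?_
    rw [← hb, ← ha, hc]
  have h := evolutionOp_family H hy (by simpa [e1, e2] using hx) e2 hcrit
    (P.hasDerivAt_curv₁ hy) (P.hasDerivAt_curv₂ hy) (hasDerivAt_along₁ H hy e2)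
  refine h.trans ?_
  simp only [Matrix.cons_val_zero, quot₁, quot₂, e1, e2, e3, e4, e5, e6, e7, e8, e9, e10, e11,
    show P.σ = σ from rfl, show P.B = B from rfl]
  field_simp

end Cap

/-- The terms of `L(w)` that are quadratic in the derivatives of the second fundamental form, at
a critical point of `w` where the principal curvatures are `x` and `1`, up to a positive factor. -/
noncomputable def gradientTerms (σ d x v v₁ v₂ : ℝ) : ℝ :=
  v₁ * ((σ - 1) * (d * v - 2 * x * v₁) ^ 2 / x - 2 * v₁ * (d * v - x * v₁)) -
    2 * (d * v - x * v₁) * v₁ ^ 2 - d * v * (d * v * v₂ - (d - 1) * v₁ ^ 2) -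
    2 * x * ((1 + x) * v₁ - d * v) / (x - 1) * v₁ ^ 2

/-- Subtracting the value of L(w) on the equator removes the terms free of derivatives of h.
Criticality makes a a multiple of b, so the rest is a multiple of b². The denominator x - 1 arises
because tan φ equals b / (1/x - 1). -/
theorem IsMaximumPrincipleFunction.gradientTerms_nonpos {σ : ℝ} (hσ : 0 < σ)
    {p q : MvPolynomial (Fin 2) ℝ} (h : IsMaximumPrincipleFunction (gaussPower σ) p q)
    {d : ℕ} {v v₁ v₂ : ℝ → ℝ} (H : IsHomogeneousRatio p q d v v₁ v₂) {x : ℝ} (hx : 1 < x)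
    (hv₁ : v₁ x ≠ 0) :
    gradientTerms σ d x (v x) (v₁ x) (v₂ x) ≤ 0 := by
  have hx0 : 0 < x := by linarith
  have hx1 : x - 1 ≠ 0 := by linarith
  have hc4 : 0 < Real.cos (Real.pi / 4) := by rw [Real.cos_pi_div_four]; positivity
  have hc0 : 0 < Real.cos 0 := by rw [Real.cos_zero]; exact one_pos
  set b : ℝ := 1 / x - 1 with hb
  -- The critical point equation d b v + v₁ (a - x b) = 0 solved for a; then B is read off from a =
  -- -B x².
  set a : ℝ := x * b - d * b * v x / v₁ x with ha
  set B : ℝ := -a / x ^ 2 with hB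
  -- The normal angle π/4 is a convenient position off the equator, with tan φ = 1. The second
  -- surface has φ = 0 and B = 0, so its point lies on the equator of a surface with circular
  -- profile.
  set P := Cap.normalized σ x (Real.pi / 4) B
  set Q := Cap.normalized σ x 0 0
  have hyP : (![Real.pi / 4, 0] : Param) 0 ∈ P.domain := Cap.mem_domain_normalized hx0 hc4
  have hyQ : (![0, 0] : Param) 0 ∈ Q.domain := Cap.mem_domain_normalized hx0 hc0
  have k1P : P.k₁ ((![Real.pi / 4, 0] : Param) 0) = x := Cap.k₁_normalized
  have k2P : P.k₂ ((![Real.pi / 4, 0] : Param) 0) = 1 := Cap.k₂_normalized hc4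
  have k1Q : Q.k₁ ((![0, 0] : Param) 0) = x := Cap.k₁_normalized
  have k2Q : Q.k₂ ((![0, 0] : Param) 0) = 1 := Cap.k₂_normalized hc0
  have hcrit : d * b * v x + v₁ x * (a - x * b) = 0 := by
    rw [ha]; field_simp; ring
  have hcP : IsCriticalPoint p q (P.family 0) ![Real.pi / 4, 0] := by
    refine Cap.isCriticalPoint H hyP (by rw [k1P, k2P]; exact hx) ?_
    refine (Cap.along₁_normalized hc4).trans ?_
    rw [Real.tan_pi_div_four, one_mul, ← hb, ← hcrit, hB]
    field_simp
  have hsame : SamePrincipalCurvatures (P.family 0) ![Real.pi / 4, 0] (Q.family 0) ![0, 0] := by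
    obtain ⟨h1, h2⟩ := P.kappa_family_zero hyP (by rw [k1P, k2P]; exact hx.le)
    obtain ⟨h3, h4⟩ := Q.kappa_family_zero hyQ (by rw [k1Q, k2Q]; exact hx.le)
    exact ⟨by rw [h1, h3, k1P, k1Q], by rw [h2, h4, k2P, k2Q]⟩
  have hle := h.gradient_terms P.region Q.region P.family Q.family 0 0 _ _ P.isFlowAt
    (P.mem_region hyP) hcP Q.isFlowAt (Q.mem_region hyQ)
    (Cap.covSecondFormVanishes rfl hyQ Real.sin_zero) hsame
  have hB' : -B * x ^ 2 = a := by rw [hB]; field_simp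
  rw [Cap.evolutionOp_normalized H hx hc4 hB'.symm (by rw [Real.tan_pi_div_four, one_mul]) rfl rfl
      hcrit,
    Cap.evolutionOp_normalized H hx hc0 (a := 0) (b := 0) (s := 0) (by simp) (by simp) rfl
      (by simp) (by simp),
    ← mul_sub, Real.tan_pi_div_four, Real.tan_zero] at hle
  have hle' := nonpos_of_mul_nonpos_right hle (Real.rpow_pos_of_pos hx0 σ)
  have hb0 : b ≠ 0 := by
    rw [hb, one_div, sub_ne_zero]
    exact (inv_lt_one_of_one_lt₀ hx).ne
  -- This is the positive factor between `gradientTerms` and the difference of the two values of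
  -- L(w), once x^σ has been divided out.
  have hpos : 0 < σ * x * (b / v₁ x) ^ 2 := by positivity
  refine nonpos_of_mul_nonpos_right (le_of_eq_of_le ?_ hle') hpos
  rw [gradientTerms, hB, ha, hb]
  field_simp
  ring

-- In the scale-invariant quantities l = x v'/v, μ = x² v''/v and ε = 1/x, the expression is v³/x²
-- times a function `G` that is continuous near (m, m(m - 1), 0). Its sign for large x is therefore
-- that of the limit of `G`.
open Filter Topology in
theorem eventually_gradientTerms_pos {σ d m : ℝ} (hσ : 1 < σ) (hd : 0 < d) (hm : d ≤ m)
    {v v₁ v₂ : ℝ → ℝ} (hv : ∀ᶠ x in atTop, 0 < v x)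
    (h₁ : Tendsto (fun x => x * v₁ x / v x) atTop (𝓝 m))
    (h₂ : Tendsto (fun x => x ^ 2 * v₂ x / v x) atTop (𝓝 (m * (m - 1)))) :
    ∀ᶠ x in atTop, 0 < gradientTerms σ d x (v x) (v₁ x) (v₂ x) := by
  have hinv : Tendsto (fun x : ℝ => x⁻¹) atTop (𝓝 0) := tendsto_inv_atTop_zero
  let G : ℝ → ℝ → ℝ → ℝ := fun l μ ε =>
    (σ - 1) * l * (d - 2 * l) ^ 2 - 4 * l ^ 2 * (d - l) - d * (d * μ - (d - 1) * l ^ 2) -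
      2 * l ^ 2 * ((ε + 1) * l - d) / (1 - ε)
  have hG : Tendsto (fun x => G (x * v₁ x / v x) (x ^ 2 * v₂ x / v x) x⁻¹) atTop
      (𝓝 (G m (m * (m - 1)) 0)) := by
    have t1 := (h₁.const_mul (σ - 1)).mul (((h₁.const_mul 2).const_sub d).pow 2)
    have t2 := ((h₁.pow 2).const_mul 4).mul (h₁.const_sub d)
    have t3 := ((h₂.const_mul d).sub ((h₁.pow 2).const_mul (d - 1))).const_mul d
    have t4 := (((h₁.pow 2).const_mul 2).mul (((hinv.add_const 1).mul h₁).sub_const d)).div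
      (hinv.const_sub 1) (by norm_num)
    exact ((t1.sub t2).sub t3).sub t4
  have hpos : 0 < G m (m * (m - 1)) 0 := by
    -- Both summands are nonnegative because 0 < d ≤ m, and the first is positive because σ > 1 and
    -- 2m - d > 0.
    have e : G m (m * (m - 1)) 0 =
        m * ((σ - 1) * (2 * m - d) ^ 2 + (2 * m - d) * (m - d)) := by
      simp only [G, sub_zero, div_one]; ring
    rw [e]
    have h1 : 0 < 2 * m - d := by linarith
    have h2 : 0 < σ - 1 := by linarith
    have h3 : 0 ≤ m - d := by linarith
    have h4 : 0 < m := by linarith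
    positivity
  filter_upwards [hG.eventually_const_lt hpos, hv, eventually_gt_atTop 1] with x h h0 hx
  have hx0 : 0 < x := by linarith
  have hx1 : x - 1 ≠ 0 := by linarith
  have hx2 : 1 - x⁻¹ ≠ 0 := (sub_pos.2 (inv_lt_one_of_one_lt₀ hx)).ne'
  have hx3 : 1 - x⁻¹ = (x - 1) / x := by field_simp
  have e : gradientTerms σ d x (v x) (v₁ x) (v₂ x) =
      v x ^ 3 / x ^ 2 * G (x * v₁ x / v x) (x ^ 2 * v₂ x / v x) x⁻¹ := by
    simp only [G, gradientTerms, hx3]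
    field_simp
    ring
  rw [e]
  positivity

end MPF

open MPF Filter in
theorem theorem1p1 (σ : ℝ) (hσ : 1 < σ) :
    ¬ ∃ p q : MvPolynomial (Fin 2) ℝ,
      MPF.IsMaximumPrincipleFunction (MPF.gaussPower σ) p q := by
  rintro ⟨p, q, h⟩
  have hd : (1 : ℝ) ≤ (p.totalDegree - q.totalDegree : ℕ) := by
    exact_mod_cast h.isHomogeneousRatio.one_le
  have hm : ((p.totalDegree - q.totalDegree : ℕ) : ℝ) ≤
      (dehomogenize p).natDegree - (dehomogenize q).natDegree := by
    have := h.degree_le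
    rw [le_sub_iff_add_le, add_comm]
    exact_mod_cast this
  have hv : ∀ᶠ x in atTop, 0 < (dehomogenize p).eval x / (dehomogenize q).eval x := by
    filter_upwards [eventually_eval_ne_zero h.dehomogenize_ne_zero, eventually_gt_atTop 0]
      with x hx hx0
    refine div_pos (lt_of_le_of_ne ?_ hx.symm) (h.eval_dehomogenize_pos hx0)
    rw [eval_dehomogenize]
    exact h.p_nonneg x 1 hx0 one_pos
  have hev := eventually_gradientTerms_pos hσ (by linarith) hm hv
    (tendsto_logDeriv_quot h.dehomogenize_ne_zero h.dehomogenize_ne_zero')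
    (tendsto_logDeriv₂_quot h.dehomogenize_ne_zero h.dehomogenize_ne_zero')
  obtain ⟨x, hx, hx1⟩ := (hev.and (eventually_gt_atTop 1)).exists
  exact absurd (h.gradientTerms_nonpos (by linarith) h.isHomogeneousRatio hx1
    (h.quotDeriv_pos hx1).ne') (not_le.2 hx)
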